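/- **Setting.** Let $q=(\gamma_{ij},\alpha,\beta^i)$ be the spatial metric, lapse and shift in three space dimensions and $p=(\pi^{ij},\sigma,\rho_i)$ the conjugate momenta. For real parameters $C_1,\dots,C_7$ consider the Hamiltonian formulation of general relativity whose canonical equations of motion have the principal part $$\partial_t q = F^i\partial_i q+M^{-1}p,\qquad \partial_t p = V^{ij}\partial_i\partial_j q+F^{i\dagger}\partial_i p ,$$ where, at a background with $\gamma_{ij}$ positive definite, $\alpha>0$ and $\beta^i$ arbitrary (with $\gamma=\det(\gamma_{ij})$ inside powers), and with rows and columns ordered as $(\gamma,\alpha,\beta)$ and $(\pi,\sigma,\rho)$, $$M^{-1}=\alpha\gamma^{-1/2}\begin{pmatrix}2\gamma_{k(m}\gamma_{n)l}-\gamma_{kl}\gamma_{mn}&-(\tfrac12+C_1)\alpha\gamma_{kl}&0\\-(\tfrac12+C_1)\alpha\gamma_{mn}&(\tfrac14+2C_4)\alpha^2&0\\0&0&-(1+2C_6)\alpha^2\gamma^{km}\end{pmatrix},$$ $$F^j=\begin{pmatrix}\beta^j\delta^{(m}_{l}\delta^{n)}_{k}&0&2\delta^j_{(l}\gamma_{k)m}\\0&\beta^j&C_7\alpha\delta^j_m\\\alpha^2\big((1+C_2)\gamma^{j(m}\gamma^{n)k}-\tfrac12(C_2-C_3+1)\gamma^{jk}\gamma^{mn}\big)&-(1+C_5)\alpha\gamma^{jk}&\beta^j\delta^k_m\end{pmatrix},$$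 $$V^{ij}=\gamma^{1/2}\begin{pmatrix}V_{11}^{ij\,kl\,mn}&\gamma^{i(k}\gamma^{l)j}-\gamma^{ij}\gamma^{kl}&0\\\gamma^{i(m}\gamma^{n)j}-\gamma^{ij}\gamma^{mn}&0&0\\0&0&0\end{pmatrix},$$ $$V_{11}^{ij\,kl\,mn}=-\tfrac{\alpha}{2}\big(\gamma^{ij}\gamma^{kl}\gamma^{mn}+\gamma^{i(k}\gamma^{l)(m}\gamma^{n)j}+\gamma^{i(m}\gamma^{n)(k}\gamma^{l)j}-\gamma^{ij}\gamma^{k(m}\gamma^{n)l}-\gamma^{kl}\gamma^{i(m}\gamma^{n)j}-\gamma^{mn}\gamma^{i(k}\gamma^{l)j}\big),$$ and $F^{i\dagger}$ is the adjoint of $F^i$ for the pairing $\pi^{ij}\gamma_{ij}+\sigma\alpha+\rho_i\beta^i$. If $M^{-1}$ is invertible, with inverse $M$, the equations have the fully second order form $$\partial_t^2q=M^{-1}\big[V^{ij}-F^{\dagger(i}MF^{j)}\big]\partial_i\partial_jq+\big[F^iM^{-1}+M^{-1}F^{\dagger i}\big]M\,\partial_i\partial_tq+\dots$$ A first order system $\partial_tu=A^p\partial_pu+\dots$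 is *strongly hyperbolic* if its principal symbol $A^ps_p$ has, for $s\neq0$, real eigenvalues and a complete set of eigenvectors depending continuously (locally in $s$) on the covector $s$. A system $\partial_tv=A_1^i\partial_iv+A_2w+\dots$, $\partial_tw=B_1^{ij}\partial_i\partial_jv+B_2^i\partial_iw+\dots$ is strongly hyperbolic if it has a strongly hyperbolic first order reduction in the variables $(v,d_i,w)$, with $d_i$ standing for $\partial_iv$; its principal symbol is $\begin{pmatrix}A_1^is_i&A_2\\B_1^{ij}s_is_j&B_2^is_i\end{pmatrix}$. A fully second order system is such a system with $(v,w)=(q,\partial_tq)$. Define the real numbers (which may have any sign) $$\lambda_V^2=1+C_2,\qquad 2\lambda_\pm^2=(2C_1+C_2+C_3-C_7+2)\pm(-2C_1+C_2+C_3+C_7),$$ $$\Delta=(\lambda_+^2-\lambda_-^2)^2+C_5^2C_7^2-2C_5C_7(\lambda_+^2+\lambda_-^2),\qquad 2v_\pm^2=\lambda_+^2+\lambda_-^2-C_5C_7\pm\sqrt\Delta .$$ **Theorem.** Fix a background as above and suppose that $M^{-1}$ is invertible. The following are equivalent: 1. the canonical (first order in time, second order in space) system is strongly hyperbolic; 2.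 its principal symbol has, for $s\ne0$, real eigenvalues and a complete set of eigenvectors depending continuously (locally) on $s$; 3. the fully second order system is strongly hyperbolic; 4. the principal symbol of the fully second order system has the property in 2; 5. $(C_1,\dots,C_7)$ belongs to $\mathcal F_1\cup\mathcal F_2\cup\mathcal F_3$. Here all three families require $$C_6=\tfrac12(\lambda_V^2-1),\qquad \lambda_V^2>0,\qquad \Delta\ge0,\qquad v_+^2>0,\qquad v_-^2>0,$$ and in addition: * $\mathcal F_1$ (four free parameters $\lambda_+^2,\lambda_-^2,C_5,C_7$): $\lambda_-^2\ne0$, $v_+^2\neq v_-^2$, $(1+2C_5)\lambda_-^2-\lambda_+^2\neq0$, $$4\lambda_V^2=3\lambda_+^2+1+\frac{C_5\lambda_-^2+3C_7\lambda_+^2}{(1+2C_5)\lambda_-^2-\lambda_+^2}\,C_5,\qquad 8C_4=\lambda_-^2-1+\frac{C_5\lambda_-^2+3C_7\lambda_+^2}{(1+2C_5)\lambda_-^2-\lambda_+^2}\,C_7 .$$ * $\mathcal F_2$ (three free parameters $\lambda_-^2,\lambda_V^2,C_7$): $\lambda_-^2\ne0$, $v_+^2\neq v_-^2$, $C_7\ne0$,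 $C_7\neq-\tfrac16$, $$12C_4=3\lambda_-^2-3-9C_7-2(1+6C_7)(\lambda_V^2-1),\qquad C_5=-\frac{3C_7}{1+6C_7},\qquad \lambda_+^2=\frac{\lambda_-^2}{1+6C_7}.$$ * $\mathcal F_3$ (one free parameter $\lambda_+^2>0$, equal scalar speeds $v_+^2=v_-^2$): $\lambda_-^2=\lambda_+^2>0$, $C_5=C_7=0$, $$4\lambda_V^2=3\lambda_+^2+1,\qquad 8C_4=\lambda_+^2-1 .$$ -/

import Mathlib

open scoped Topology Matrix

noncomputable section

/-! ## Hyperbolicity in three space dimensions -/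

section Hyperbolicity

/-- A family `P s` of endomorphisms (a principal symbol), indexed by spatial covectors `s`, has
real eigenvalues and a complete set of eigenvectors which depend continuously on `s ≠ 0`.
The continuous choice of eigenvectors is local in `s`: eigenvectors tangential to the sphere of
directions cannot be chosen continuously on the whole sphere. -/
def HasContinuousEigenbasis {E : Type*} [AddCommGroup E] [Module ℝ E] [TopologicalSpace E]
    (P : (Fin 3 → ℝ) → Module.End ℝ E) : Prop :=
  ∀ s₀ : Fin 3 → ℝ, s₀ ≠ 0 → ∃ U ∈ 𝓝 s₀,
    ∃ (e : (Fin 3 → ℝ) → Module.Basis (Fin (Module.finrank ℝ E)) ℝ E)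
      (μ : (Fin 3 → ℝ) → Fin (Module.finrank ℝ E) → ℝ),
      (∀ k, ContinuousOn (fun s => e s k) U) ∧
      ∀ s ∈ U, ∀ k, P s (e s k) = μ s k • e s k

/-- The principal symbol `A^p s_p` of the first order system `∂_t u = A^p ∂_p u + S`. -/
def firstOrderSymbol {E : Type*} [AddCommGroup E] [Module ℝ E]
    (A : Fin 3 → Module.End ℝ E) (s : Fin 3 → ℝ) : Module.End ℝ E :=
  ∑ p, s p • A p

/-- Strong hyperbolicity of the first order system `∂_t u = A^p ∂_p u + S`. -/
def IsStronglyHyperbolicFirstOrder {E : Type*} [AddCommGroup E] [Module ℝ E] [TopologicalSpace E]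
    (A : Fin 3 → Module.End ℝ E) : Prop :=
  HasContinuousEigenbasis (firstOrderSymbol A)

/-- The principal part of a system that is first order in time and second order in space,
`∂_t v = A₁^i ∂_i v + A₂ w + …`,
`∂_t w = B₁^{ij} ∂_i ∂_j v + B₂^i ∂_i w + …`. -/
structure SecondOrderSystem (V W : Type*) [AddCommGroup V] [Module ℝ V]
    [AddCommGroup W] [Module ℝ W] where
  A₁ : Fin 3 → V →ₗ[ℝ] V
  A₂ : W →ₗ[ℝ] V
  B₁ : Fin 3 → Fin 3 → V →ₗ[ℝ] W
  B₂ : Fin 3 → W →ₗ[ℝ] W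

namespace SecondOrderSystem

variable {V W : Type*} [AddCommGroup V] [Module ℝ V] [AddCommGroup W] [Module ℝ W]

/-- The principal symbol, the block matrix `(A₁^i s_i, A₂; B₁^{ij} s_i s_j, B₂^i s_i)`. -/
def symbol (S : SecondOrderSystem V W) (s : Fin 3 → ℝ) : Module.End ℝ (V × W) :=
  LinearMap.prod
    (LinearMap.coprod (∑ i, s i • S.A₁ i) S.A₂)
    (LinearMap.coprod (∑ i, ∑ j, (s i * s j) • S.B₁ i j) (∑ i, s i • S.B₂ i))

/-- `A` is the principal part of a reduction to first order of the system `S`, with variables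
`u = (v, d_i, w)`, where `d_i` is a new variable that stands for `∂_i v`.

Substituting `d_i = ∂_i v` into `∂_t u = A^p ∂_p u + …` has to give back the equation for `v`,
the `i`-th derivative of the equation for `v`, and the equation for `w`. After the substitution
`h i j = ∂_i ∂_j v` is symmetric, `ω i = ∂_i w`, and `∂_p v = d_p` is of lower order, so that the
coefficient of `∂_p v` is free; multiples of the constraints `d_i - ∂_i v` and
`∂_i d_j - ∂_j d_i` (and of derivatives of the former) may thus have been added. -/
def IsReduction (S : SecondOrderSystem V W)
    (A : Fin 3 → Module.End ℝ (V × (Fin 3 → V) × W)) : Prop :=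
  ∀ (h : Fin 3 → Fin 3 → V) (ω : Fin 3 → W), (∀ i j, h i j = h j i) →
    ∑ p, A p (0, h p, ω p) =
      (0,
       fun i => ∑ j, S.A₁ j (h i j) + S.A₂ (ω i),
       ∑ i, ∑ j, S.B₁ i j (h i j) + ∑ i, S.B₂ i (ω i))

/-- A system is strongly hyperbolic if it has a strongly hyperbolic first order reduction. -/
def IsStronglyHyperbolic [TopologicalSpace V] [TopologicalSpace W]
    (S : SecondOrderSystem V W) : Prop :=
  ∃ A : Fin 3 → Module.End ℝ (V × (Fin 3 → V) × W),
    S.IsReduction A ∧ IsStronglyHyperbolicFirstOrder A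

end SecondOrderSystem

/-- The fully second order system
`∂_t² q = 𝒜^{ij} ∂_i ∂_j q + ℬ^i ∂_i ∂_t q + …` as a system for `(v, w) = (q, ∂_t q)`. -/
def fullySecondOrderSystem {Q : Type*} [AddCommGroup Q] [Module ℝ Q]
    (𝒜 : Fin 3 → Fin 3 → Module.End ℝ Q) (ℬ : Fin 3 → Module.End ℝ Q) :
    SecondOrderSystem Q Q where
  A₁ := fun _ => 0
  A₂ := LinearMap.id
  B₁ := 𝒜
  B₂ := ℬ

end Hyperbolicity

namespace HamiltonianGR

/-! ## The Hamiltonian formulations of general relativity -/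

/-- Symmetric tensors with two indices in dimension three. -/
def SymTensor : Submodule ℝ (Matrix (Fin 3) (Fin 3) ℝ) where
  carrier := {h | h.IsSymm}
  add_mem' := fun ha hb => ha.add hb
  zero_mem' := Matrix.isSymm_zero
  smul_mem' := fun c _ h => h.smul c

/-- The symmetric tensor with given components. -/
def SymTensor.mk (f : Fin 3 → Fin 3 → ℝ) (hf : ∀ k l, f k l = f l k) : SymTensor :=
  ⟨Matrix.of f, by ext k l; exact hf l k⟩

/-- Values of the canonical positions `(γ_{ij}, α, β^i)`, and also of the conjugate canonical
momenta `(π^{ij}, σ, ρ_i)`. -/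
abbrev Fields : Type := SymTensor × ℝ × (Fin 3 → ℝ)

/-- The formulation parameters `C_1, …, C_7`. -/
structure Parameters where
  C₁ : ℝ
  C₂ : ℝ
  C₃ : ℝ
  C₄ : ℝ
  C₅ : ℝ
  C₆ : ℝ
  C₇ : ℝ

/-- The background values of the spatial metric, the lapse and the shift at a point. -/
structure Background where
  γ : Matrix (Fin 3) (Fin 3) ℝ
  γ_posDef : γ.PosDef
  α : ℝ
  α_pos : 0 < α
  β : Fin 3 → ℝ

namespace Background

/-- The square root of the determinant of the spatial metric. -/
def vol (b : Background) : ℝ := √b.γ.det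

/-- The inverse spatial metric `γ^{ij}`. -/
def inv (b : Background) : Matrix (Fin 3) (Fin 3) ℝ := b.γ⁻¹

theorem γ_symm (b : Background) (i j : Fin 3) : b.γ i j = b.γ j i := by
  have h := b.γ_posDef.isHermitian.apply j i
  simpa using h

theorem inv_symm (b : Background) (i j : Fin 3) : b.inv i j = b.inv j i := by
  have h := b.γ_posDef.isHermitian.inv.apply j i
  simpa [inv] using h

/-- `p_{kl} = γ_{km} γ_{ln} p^{mn}`. -/
def lower (b : Background) (p : SymTensor) (k l : Fin 3) : ℝ :=
  ∑ m, ∑ n, b.γ k m * b.γ l n * p.1 m n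

/-- `h^{kl} = γ^{km} γ^{ln} h_{mn}`. -/
def raise (b : Background) (h : SymTensor) (k l : Fin 3) : ℝ :=
  ∑ m, ∑ n, b.inv k m * b.inv l n * h.1 m n

/-- `γ_{mn} p^{mn}`. -/
def trUp (b : Background) (p : SymTensor) : ℝ := ∑ m, ∑ n, b.γ m n * p.1 m n

/-- `γ^{mn} h_{mn}`. -/
def trDown (b : Background) (h : SymTensor) : ℝ := ∑ m, ∑ n, b.inv m n * h.1 m n

/-- `γ^{i(k} γ^{l)j}`. -/
def invSym (b : Background) (i j k l : Fin 3) : ℝ :=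
  (b.inv i k * b.inv l j + b.inv i l * b.inv k j) / 2

theorem symTensor_symm (h : SymTensor) (i j : Fin 3) : h.1 i j = h.1 j i := h.2.apply j i

theorem lower_symm (b : Background) (p : SymTensor) (k l : Fin 3) :
    b.lower p k l = b.lower p l k := by
  unfold lower
  rw [Finset.sum_comm]
  refine Finset.sum_congr rfl fun m _ => Finset.sum_congr rfl fun n _ => ?_
  rw [symTensor_symm p n m]; ring

theorem raise_symm (b : Background) (h : SymTensor) (k l : Fin 3) :
    b.raise h k l = b.raise h l k := by
  unfold raise
  rw [Finset.sum_comm]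
  refine Finset.sum_congr rfl fun m _ => Finset.sum_congr rfl fun n _ => ?_
  rw [symTensor_symm h n m]; ring

theorem lower_add (b : Background) (p p' : SymTensor) (k l : Fin 3) :
    b.lower (p + p') k l = b.lower p k l + b.lower p' k l := by
  simp [lower, mul_add, Finset.sum_add_distrib]

theorem lower_smul (b : Background) (c : ℝ) (p : SymTensor) (k l : Fin 3) :
    b.lower (c • p) k l = c * b.lower p k l := by
  simp only [lower, Finset.mul_sum, Submodule.coe_smul, Matrix.smul_apply, smul_eq_mul]
  refine Finset.sum_congr rfl fun m _ => Finset.sum_congr rfl fun n _ => ?_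
  ring

theorem raise_add (b : Background) (p p' : SymTensor) (k l : Fin 3) :
    b.raise (p + p') k l = b.raise p k l + b.raise p' k l := by
  simp [raise, mul_add, Finset.sum_add_distrib]

theorem raise_smul (b : Background) (c : ℝ) (p : SymTensor) (k l : Fin 3) :
    b.raise (c • p) k l = c * b.raise p k l := by
  simp only [raise, Finset.mul_sum, Submodule.coe_smul, Matrix.smul_apply, smul_eq_mul]
  refine Finset.sum_congr rfl fun m _ => Finset.sum_congr rfl fun n _ => ?_
  ring

theorem trUp_add (b : Background) (p p' : SymTensor) :
    b.trUp (p + p') = b.trUp p + b.trUp p' := by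
  simp [trUp, mul_add, Finset.sum_add_distrib]

theorem trUp_smul (b : Background) (c : ℝ) (p : SymTensor) :
    b.trUp (c • p) = c * b.trUp p := by
  simp only [trUp, Finset.mul_sum, Submodule.coe_smul, Matrix.smul_apply, smul_eq_mul]
  refine Finset.sum_congr rfl fun m _ => Finset.sum_congr rfl fun n _ => ?_
  ring

theorem trDown_add (b : Background) (p p' : SymTensor) :
    b.trDown (p + p') = b.trDown p + b.trDown p' := by
  simp [trDown, mul_add, Finset.sum_add_distrib]

theorem trDown_smul (b : Background) (c : ℝ) (p : SymTensor) :
    b.trDown (c • p) = c * b.trDown p := by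
  simp only [trDown, Finset.mul_sum, Submodule.coe_smul, Matrix.smul_apply, smul_eq_mul]
  refine Finset.sum_congr rfl fun m _ => Finset.sum_congr rfl fun n _ => ?_
  ring

/-- `γ_{km} b^m`. -/
def lowerVec (b : Background) (v : Fin 3 → ℝ) (k : Fin 3) : ℝ := ∑ m, b.γ k m * v m

/-- `γ^{km} r_m`. -/
def raiseVec (b : Background) (r : Fin 3 → ℝ) (k : Fin 3) : ℝ := ∑ m, b.inv k m * r m

/-- `p^{j}{}_{k} = γ_{km} p^{jm}`. -/
def lowerOne (b : Background) (p : SymTensor) (j k : Fin 3) : ℝ := ∑ m, b.γ k m * p.1 j m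

theorem lowerVec_add (b : Background) (v v' : Fin 3 → ℝ) (k : Fin 3) :
    b.lowerVec (v + v') k = b.lowerVec v k + b.lowerVec v' k := by
  simp [lowerVec, mul_add, Finset.sum_add_distrib]

theorem lowerVec_smul (b : Background) (c : ℝ) (v : Fin 3 → ℝ) (k : Fin 3) :
    b.lowerVec (c • v) k = c * b.lowerVec v k := by
  simp only [lowerVec, Finset.mul_sum, Pi.smul_apply, smul_eq_mul]
  exact Finset.sum_congr rfl fun m _ => by ring

theorem raiseVec_add (b : Background) (v v' : Fin 3 → ℝ) (k : Fin 3) :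
    b.raiseVec (v + v') k = b.raiseVec v k + b.raiseVec v' k := by
  simp [raiseVec, mul_add, Finset.sum_add_distrib]

theorem raiseVec_smul (b : Background) (c : ℝ) (v : Fin 3 → ℝ) (k : Fin 3) :
    b.raiseVec (c • v) k = c * b.raiseVec v k := by
  simp only [raiseVec, Finset.mul_sum, Pi.smul_apply, smul_eq_mul]
  exact Finset.sum_congr rfl fun m _ => by ring

theorem lowerOne_add (b : Background) (p p' : SymTensor) (j k : Fin 3) :
    b.lowerOne (p + p') j k = b.lowerOne p j k + b.lowerOne p' j k := by
  simp [lowerOne, mul_add, Finset.sum_add_distrib]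

theorem lowerOne_smul (b : Background) (c : ℝ) (p : SymTensor) (j k : Fin 3) :
    b.lowerOne (c • p) j k = c * b.lowerOne p j k := by
  simp only [lowerOne, Finset.mul_sum, Submodule.coe_smul, Matrix.smul_apply, smul_eq_mul]
  exact Finset.sum_congr rfl fun m _ => by ring

end Background

theorem Fields.ext {x y : Fields} (h1 : ∀ k l, x.1.1 k l = y.1.1 k l) (h2 : x.2.1 = y.2.1)
    (h3 : ∀ k, x.2.2 k = y.2.2 k) : x = y :=
  Prod.ext (Subtype.ext (Matrix.ext h1)) (Prod.ext h2 (funext h3))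

open Background

/-! The Hamiltonian density is, up to terms that do not contribute to the principal part of the
equations of motion and up to divergences,
`½ ∂_i q · V^{ij} ∂_j q + p · F^i ∂_i q + ½ p · M⁻¹ p`, with `q = (γ_{ij}, α, β^i)`,
`p = (π^{ij}, σ, ρ_i)` and the canonical pairing
`p · q = π^{ij} γ_{ij} + σ α + ρ_i β^i`. -/

/-- The canonical pairing of momenta and positions. -/
def pairing (p q : Fields) : ℝ :=
  ∑ k, ∑ l, p.1.1 k l * q.1.1 k l + p.2.1 * q.2.1 + ∑ k, p.2.2 k * q.2.2 k

/-- The block `M⁻¹`, which maps momenta `(p^{kl}, σ, ρ_k)` to positions. -/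
def Minv (C : Parameters) (b : Background) : Module.End ℝ Fields where
  toFun p :=
    (SymTensor.mk
      (fun k l => b.α / b.vol *
        (2 * b.lower p.1 k l - b.γ k l * b.trUp p.1 - (1 / 2 + C.C₁) * b.α * b.γ k l * p.2.1))
      (fun k l => by rw [b.lower_symm, b.γ_symm k l]),
     b.α / b.vol *
        (-(1 / 2 + C.C₁) * b.α * b.trUp p.1 + (1 / 4 + 2 * C.C₄) * b.α ^ 2 * p.2.1),
     fun k => b.α / b.vol * (-(1 + 2 * C.C₆) * b.α ^ 2 * b.raiseVec p.2.2 k))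
  map_add' p p' := by
    refine Fields.ext (fun k l => ?_) ?_ (fun k => ?_) <;>
    simp [SymTensor.mk, lower_add, trUp_add, raiseVec_add] <;> ring
  map_smul' c p := by
    refine Fields.ext (fun k l => ?_) ?_ (fun k => ?_) <;>
    simp [SymTensor.mk, lower_smul, trUp_smul, raiseVec_smul] <;> ring

/-- The block `F^j`, which maps positions `(h_{kl}, a, b^k)` to positions. -/
def F (C : Parameters) (b : Background) (j : Fin 3) : Module.End ℝ Fields where
  toFun q :=
    (SymTensor.mk
      (fun k l => b.β j * q.1.1 k l +
        ((if j = k then b.lowerVec q.2.2 l else 0) + (if j = l then b.lowerVec q.2.2 k else 0)))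
      (fun k l => by rw [symTensor_symm, add_comm (ite _ _ _)]),
     b.β j * q.2.1 + C.C₇ * b.α * q.2.2 j,
     fun k => b.α ^ 2 * ((1 + C.C₂) * b.raise q.1 j k -
          1 / 2 * (C.C₂ - C.C₃ + 1) * b.inv j k * b.trDown q.1) -
        (1 + C.C₅) * b.α * b.inv j k * q.2.1 + b.β j * q.2.2 k)
  map_add' p p' := by
    refine Fields.ext (fun k l => ?_) ?_ (fun k => ?_) <;>
    simp [SymTensor.mk, lowerVec_add, raise_add, trDown_add]
    · split_ifs <;> ring
    all_goals ring
  map_smul' c p := by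
    refine Fields.ext (fun k l => ?_) ?_ (fun k => ?_) <;>
    simp [SymTensor.mk, lowerVec_smul, raise_smul, trDown_smul]
    · split_ifs <;> ring
    all_goals ring

/-- The block `F^{j†}`, which maps momenta `(p^{kl}, σ, ρ_k)` to momenta. -/
def Fdag (C : Parameters) (b : Background) (j : Fin 3) : Module.End ℝ Fields where
  toFun p :=
    (SymTensor.mk
      (fun k l => b.β j * p.1.1 k l + b.α ^ 2 *
        ((1 + C.C₂) * ((b.inv j k * b.raiseVec p.2.2 l + b.inv j l * b.raiseVec p.2.2 k) / 2) -
          1 / 2 * (C.C₂ - C.C₃ + 1) * b.raiseVec p.2.2 j * b.inv k l))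
      (fun k l => by rw [symTensor_symm, b.inv_symm k l]; ring),
     b.β j * p.2.1 - (1 + C.C₅) * b.α * b.raiseVec p.2.2 j,
     fun k => 2 * b.lowerOne p.1 j k + (if j = k then C.C₇ * b.α * p.2.1 else 0) +
        b.β j * p.2.2 k)
  map_add' p p' := by
    refine Fields.ext (fun k l => ?_) ?_ (fun k => ?_) <;>
    simp [SymTensor.mk, raiseVec_add, lowerOne_add]
    · ring
    · ring
    · split_ifs <;> ring
  map_smul' c p := by
    refine Fields.ext (fun k l => ?_) ?_ (fun k => ?_) <;>
    simp [SymTensor.mk, raiseVec_smul, lowerOne_smul]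
    · ring
    · ring
    · split_ifs <;> ring

/-- `F^{j†}` is the adjoint of `F^j` with respect to the canonical pairing. -/
theorem pairing_Fdag (C : Parameters) (b : Background) (j : Fin 3) (p q : Fields) :
    pairing (Fdag C b j p) q = pairing p (F C b j q) := by
  obtain ⟨p, σ, r⟩ := p
  obtain ⟨h, a, v⟩ := q
  have e1 := b.inv_symm 1 0
  have e2 := b.inv_symm 2 0
  have e3 := b.inv_symm 2 1
  have e4 := b.γ_symm 1 0
  have e5 := b.γ_symm 2 0
  have e6 := b.γ_symm 2 1
  have f1 := symTensor_symm p 1 0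
  have f2 := symTensor_symm p 2 0
  have f3 := symTensor_symm p 2 1
  have g1 := symTensor_symm h 1 0
  have g2 := symTensor_symm h 2 0
  have g3 := symTensor_symm h 2 1
  fin_cases j <;>
  simp [pairing, Fdag, F, SymTensor.mk, Fin.sum_univ_three, raiseVec, raise, trDown, lowerVec,
    lowerOne, e1, e2, e3, e4, e5, e6, f1, f2, f3, g1, g2, g3] <;> ring

/-- The block `V^{ij}`, which maps positions `(h_{kl}, a, b^k)` to momenta. -/
def V (b : Background) (i j : Fin 3) : Module.End ℝ Fields where
  toFun q :=
    (SymTensor.mk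
      (fun k l => b.vol *
        (-b.α / 2 *
          (b.inv i j * b.inv k l * b.trDown q.1 +
            (b.inv i k * b.raise q.1 l j + b.inv i l * b.raise q.1 k j) / 2 +
            (b.inv l j * b.raise q.1 i k + b.inv k j * b.raise q.1 i l) / 2 -
            b.inv i j * b.raise q.1 k l - b.inv k l * b.raise q.1 i j -
            b.invSym i j k l * b.trDown q.1) +
          (b.invSym i j k l - b.inv i j * b.inv k l) * q.2.1))
      (fun k l => by rw [b.inv_symm k l, b.raise_symm q.1 k l]; unfold invSym; ring),
     b.vol * (b.raise q.1 i j - b.inv i j * b.trDown q.1),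
     0)
  map_add' p p' := by
    refine Fields.ext (fun k l => ?_) ?_ (fun k => ?_) <;>
    simp [SymTensor.mk, raise_add, trDown_add] <;> ring
  map_smul' c p := by
    refine Fields.ext (fun k l => ?_) ?_ (fun k => ?_) <;>
    simp [SymTensor.mk, raise_smul, trDown_smul] <;> ring

/-- The canonical equations of motion
`∂_t q = M⁻¹ p + F^i ∂_i q + …`, `∂_t p = F^{i†} ∂_i p + V^{ij} ∂_i ∂_j q + …`. -/
def canonicalSystem (C : Parameters) (b : Background) : SecondOrderSystem Fields Fields where
  A₁ := F C b
  A₂ := Minv C b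
  B₁ := V b
  B₂ := Fdag C b

/-- The matrix `M`; it is the inverse of `Minv C b` whenever the latter is invertible. -/
def M (C : Parameters) (b : Background) : Module.End ℝ Fields := Ring.inverse (Minv C b)

/-- The fully second order form of the equations of motion,
`∂_t² q = M⁻¹ (V^{ij} - F^{†(i} M F^{j)}) ∂_i ∂_j q + (F^i M⁻¹ + M⁻¹ F^{†i}) M ∂_i ∂_t q + …`,
meaningful when `Minv C b` is invertible. -/
def fullySecondOrderForm (C : Parameters) (b : Background) : SecondOrderSystem Fields Fields :=
  fullySecondOrderSystem
    (fun i j => Minv C b *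
      (V b i j - (1 / 2 : ℝ) •
        (Fdag C b i * M C b * F C b j + Fdag C b j * M C b * F C b i)))
    (fun i => (F C b i * Minv C b + Minv C b * Fdag C b i) * M C b)

/-! ## The three families -/

namespace Parameters

/-- `λ_V²`. -/
def lamVSq (C : Parameters) : ℝ := 1 + C.C₂

/-- `λ_+²`, a real number that may have any sign. -/
def lamPlusSq (C : Parameters) : ℝ :=
  ((2 * C.C₁ + C.C₂ + C.C₃ - C.C₇ + 2) + (-2 * C.C₁ + C.C₂ + C.C₃ + C.C₇)) / 2

/-- `λ_-²`, a real number that may have any sign. -/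
def lamMinusSq (C : Parameters) : ℝ :=
  ((2 * C.C₁ + C.C₂ + C.C₃ - C.C₇ + 2) - (-2 * C.C₁ + C.C₂ + C.C₃ + C.C₇)) / 2

/-- The radicand in the formula for the characteristic speeds of the scalar sector. -/
def speedDisc (C : Parameters) : ℝ :=
  (C.lamPlusSq - C.lamMinusSq) ^ 2 + C.C₅ ^ 2 * C.C₇ ^ 2 -
    2 * C.C₅ * C.C₇ * (C.lamPlusSq + C.lamMinusSq)

/-- `v_+²`. -/
def vPlusSq (C : Parameters) : ℝ :=
  (C.lamPlusSq + C.lamMinusSq - C.C₅ * C.C₇ + √C.speedDisc) / 2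

/-- `v_-²`. -/
def vMinusSq (C : Parameters) : ℝ :=
  (C.lamPlusSq + C.lamMinusSq - C.C₅ * C.C₇ - √C.speedDisc) / 2

/-- The conditions that all three families have in common: the relation for `C₆`, and real and
nonzero characteristic speeds `λ_V`, `v_+`, `v_-`. -/
def CommonConditions (C : Parameters) : Prop :=
  C.C₆ = (C.lamVSq - 1) / 2 ∧ 0 < C.lamVSq ∧
    0 ≤ C.speedDisc ∧ 0 < C.vPlusSq ∧ 0 < C.vMinusSq

end Parameters

/-- The four-parameter family, with free parameters `λ_+², λ_-², C₅, C₇`. -/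
def family₁ : Set Parameters :=
  {C | C.CommonConditions ∧ C.lamMinusSq ≠ 0 ∧ C.vPlusSq ≠ C.vMinusSq ∧
    (1 + 2 * C.C₅) * C.lamMinusSq - C.lamPlusSq ≠ 0 ∧
    4 * C.lamVSq = 3 * C.lamPlusSq + 1 +
      (C.C₅ * C.lamMinusSq + 3 * C.C₇ * C.lamPlusSq) /
        ((1 + 2 * C.C₅) * C.lamMinusSq - C.lamPlusSq) * C.C₅ ∧
    8 * C.C₄ = C.lamMinusSq - 1 +
      (C.C₅ * C.lamMinusSq + 3 * C.C₇ * C.lamPlusSq) /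
        ((1 + 2 * C.C₅) * C.lamMinusSq - C.lamPlusSq) * C.C₇}

/-- The three-parameter family, with free parameters `λ_-², λ_V², C₇`. -/
def family₂ : Set Parameters :=
  {C | C.CommonConditions ∧ C.lamMinusSq ≠ 0 ∧ C.vPlusSq ≠ C.vMinusSq ∧
    C.C₇ ≠ 0 ∧ C.C₇ ≠ -1 / 6 ∧
    12 * C.C₄ = 3 * C.lamMinusSq - 3 - 9 * C.C₇ - 2 * (1 + 6 * C.C₇) * (C.lamVSq - 1) ∧
    C.C₅ = -(3 * C.C₇) / (1 + 6 * C.C₇) ∧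
    C.lamPlusSq = C.lamMinusSq / (1 + 6 * C.C₇)}

/-- The one-parameter family, with free parameter `λ_+² > 0`. -/
def family₃ : Set Parameters :=
  {C | C.CommonConditions ∧ 0 < C.lamPlusSq ∧ C.vPlusSq = C.vMinusSq ∧
    C.lamMinusSq = C.lamPlusSq ∧ C.C₅ = 0 ∧ C.C₇ = 0 ∧
    4 * C.lamVSq = 3 * C.lamPlusSq + 1 ∧ 8 * C.C₄ = C.lamPlusSq - 1}

end HamiltonianGR

end

/-! Everything reduces to the diagonalizability of one constant matrix. Near each covector `s ≠ 0`
an orthonormal frame adapted to `s` can be chosen continuously. In it, after rescaling the fields,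
the canonical symbol is the scalar `s · β` plus a nonzero multiple of `frameSymbol C`, which depends
neither on the background nor on `s` (`locallyModelled_canonicalSystem`). Since `M⁻¹` is invertible,
the change of variables `(q, p) ↦ (q, ∂_t q)` conjugates this symbol to that of the fully second
order system. Conditions 2 and 4 thus both say that `frameSymbol C` is diagonalizable over the
reals.

For first order reductions, the plane waves `d_i = s_i v` form an invariant subspace on which the
symbol of any reduction is the second order symbol, so 1 and 3 also imply diagonalizability.
Conversely, let all undetermined constraints be advected along the shift. The additional modes have
eigenvalue `s · β`; if `frameSymbol C` is invertible, this is not an eigenvalue of the second order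
symbol, so no Jordan blocks arise (`isStronglyHyperbolic_of_locallyModelled`).

In the frame, `frameSymbol C` splits into one scalar, two vector and two tensor blocks, each of the
form `(e, o) ↦ (A o, B e)` and governed by `A * B`. The tensor blocks have speed one. The vector
blocks have a Jordan block unless `1 + 2 C₆ = λ_V²`, and need `λ_V² > 0`. In the scalar block, `A *
B` is block triangular and both diagonal blocks have the characteristic polynomial `χ` with roots
`v_±²`. Diagonalizability makes `χ(A * B)` vanish, and makes `A * B` scalar if the roots coincide.
The entries of these identities are algebraic conditions whose solutions are the three families.
Vanishing scalar speeds are excluded by the invertibility of `M⁻¹`, so that diagonalizability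
already entails the invertibility needed for 1 and 3. -/

noncomputable section

/-! ### Real diagonalizability in terms of eigenfunctionals -/

/-- The eigenfunctionals of `T` separate points: over a finite dimensional space this says that
`T` is diagonalizable over the reals. -/
def EigSep {E : Type*} [AddCommGroup E] [Module ℝ E] (T : Module.End ℝ E) : Prop :=
  ∀ x : E, (∀ (f : E →ₗ[ℝ] ℝ) (μ : ℝ), (∀ y, f (T y) = μ * f y) → f x = 0) → x = 0

namespace EigSep

variable {E E' : Type*} [AddCommGroup E] [Module ℝ E] [AddCommGroup E'] [Module ℝ E']

theorem of_basis {ι : Type*} {T : Module.End ℝ E} (b : Module.Basis ι ℝ E) (μ : ι → ℝ)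
    (h : ∀ i, T (b i) = μ i • b i) : EigSep T := by
  intro x hx
  refine b.ext_elem fun i => ?_
  have key : ∀ y, b.coord i (T y) = μ i * b.coord i y := by
    intro y
    have : b.coord i ∘ₗ T = μ i • b.coord i := by
      refine b.ext fun j => ?_
      by_cases hij : j = i
      · subst hij; simp [h]
      · simp [h, hij]
    exact LinearMap.congr_fun this y
  simpa using hx (b.coord i) (μ i) key

/-- Eigenfunctionals restrict to invariant subspaces. This makes the formulation by functionals more
convenient than one by eigenvectors, which would have to be projected. -/
theorem of_injective {T : Module.End ℝ E} {T' : Module.End ℝ E'} (hT : EigSep T)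
    (J : E' →ₗ[ℝ] E) (hJ : Function.Injective J) (h : ∀ x, T (J x) = J (T' x)) : EigSep T' := by
  intro x hx
  refine hJ ?_
  rw [map_zero]
  refine hT _ fun f μ hf => hx (f ∘ₗ J) μ fun y => ?_
  simp [← h, hf]

theorem prodMap {T : Module.End ℝ E} {T' : Module.End ℝ E'} (hT : EigSep T) (hT' : EigSep T') :
    EigSep (T.prodMap T' : Module.End ℝ (E × E')) := by
  rintro ⟨x, x'⟩ hx
  have h1 : x = 0 := hT x fun f μ hf => by
    simpa using hx (f ∘ₗ LinearMap.fst ℝ E E') μ (by simp [hf])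
  have h2 : x' = 0 := hT' x' fun f μ hf => by
    simpa using hx (f ∘ₗ LinearMap.snd ℝ E E') μ (by simp [hf])
  rw [h1, h2]; rfl

theorem eq_zero_of_forall_dual {x : E} (h : ∀ f : E →ₗ[ℝ] ℝ, f x = 0) : x = 0 :=
  (Module.forall_dual_apply_eq_zero_iff ℝ x).1 h

/-- For every functional `f`, the functionals `f ∘ (T ± √c)` are eigenfunctionals, and their
difference is `2 √c f`. -/
theorem of_sq {T : Module.End ℝ E} {c : ℝ} (hc : 0 < c) (h : ∀ x, T (T x) = c • x) :
    EigSep T := by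
  intro x hx
  refine eq_zero_of_forall_dual fun f => ?_
  have hs : √c * √c = c := Real.mul_self_sqrt hc.le
  have hs0 : √c ≠ 0 := (Real.sqrt_pos.2 hc).ne'
  have h1 := hx (f ∘ₗ (T + √c • LinearMap.id)) (√c) (fun y => by
    simp only [LinearMap.comp_apply, LinearMap.add_apply, LinearMap.smul_apply, LinearMap.id_apply,
      map_add, map_smul, h, smul_eq_mul]
    linear_combination (-(f y)) * hs)
  have h2 := hx (f ∘ₗ (T - √c • LinearMap.id)) (-√c) (fun y => by
    simp only [LinearMap.comp_apply, LinearMap.sub_apply, LinearMap.smul_apply, LinearMap.id_apply,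
      map_sub, map_smul, h, smul_eq_mul]
    linear_combination (-(f y)) * hs)
  simp only [LinearMap.comp_apply, LinearMap.sub_apply, LinearMap.add_apply, LinearMap.smul_apply,
    LinearMap.id_apply, map_sub, map_add, map_smul, smul_eq_mul] at h1 h2
  have : √c * f x = 0 := by linear_combination (h1 - h2) / 2
  exact (mul_eq_zero.1 this).resolve_left hs0

/-- The functional `g = f ∘ (T² - b)` satisfies `g ∘ T² = a g`, so the argument for a single square
gives `g x = 0`. Exchanging `a` and `b` yields `a f x = f (T² x) = b f x`. -/
theorem of_sq_mul_sq {T : Module.End ℝ E} {a b : ℝ} (ha : 0 < a) (hb : 0 < b) (hab : a ≠ b)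
    (h : ∀ x, T (T (T (T x))) = (a + b) • T (T x) - (a * b) • x) : EigSep T := by
  have aux : ∀ {a b : ℝ}, 0 < a → (∀ x, T (T (T (T x))) = (a + b) • T (T x) - (a * b) • x) →
      ∀ x, (∀ (f : E →ₗ[ℝ] ℝ) (μ : ℝ), (∀ y, f (T y) = μ * f y) → f x = 0) →
      ∀ f : E →ₗ[ℝ] ℝ, f (T (T x)) = b * f x := by
    intro a b ha h x hx f
    have hs : √a * √a = a := Real.mul_self_sqrt ha.le
    have hs0 : √a ≠ 0 := (Real.sqrt_pos.2 ha).ne'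
    let g : E →ₗ[ℝ] ℝ := f ∘ₗ (T ∘ₗ T - b • LinearMap.id)
    have hg : ∀ y, g (T (T y)) = a * g y := fun y => by
      simp only [g, LinearMap.comp_apply, LinearMap.sub_apply, LinearMap.smul_apply,
        LinearMap.id_apply, map_sub, map_smul, h, smul_eq_mul]
      ring
    have h1 := hx (g ∘ₗ (T + √a • LinearMap.id)) (√a) (fun y => by
      simp only [LinearMap.comp_apply, LinearMap.add_apply, LinearMap.smul_apply,
        LinearMap.id_apply, map_add, map_smul, hg, smul_eq_mul]
      linear_combination (-(g y)) * hs)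
    have h2 := hx (g ∘ₗ (T - √a • LinearMap.id)) (-√a) (fun y => by
      simp only [LinearMap.comp_apply, LinearMap.sub_apply, LinearMap.smul_apply,
        LinearMap.id_apply, map_sub, map_smul, hg, smul_eq_mul]
      linear_combination (-(g y)) * hs)
    simp only [LinearMap.comp_apply, LinearMap.sub_apply, LinearMap.add_apply,
      LinearMap.smul_apply, LinearMap.id_apply, map_sub, map_add, map_smul, smul_eq_mul] at h1 h2
    have h3 : √a * g x = 0 := by linear_combination (h1 - h2) / 2
    have h4 : g x = 0 := (mul_eq_zero.1 h3).resolve_left hs0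
    simp only [g, LinearMap.comp_apply, LinearMap.sub_apply, LinearMap.smul_apply,
        LinearMap.id_apply, map_sub, map_smul, smul_eq_mul] at h4
    linear_combination h4
  intro x hx
  refine eq_zero_of_forall_dual fun f => ?_
  have h1 := aux ha h x hx f
  have h2 := aux (b := a) hb (fun x => by rw [h, add_comm a b, mul_comm a b]) x hx f
  have h3 : (a - b) * f x = 0 := by linear_combination h1 - h2
  exact (mul_eq_zero.1 h3).resolve_left (sub_ne_zero.2 hab)

/-- Separation of points means that the eigenfunctionals span the dual space. The basis dual to a
basis of eigenfunctionals consists of eigenvectors. -/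
theorem exists_basis [FiniteDimensional ℝ E] {T : Module.End ℝ E} (hT : EigSep T) :
    ∃ (b : Module.Basis (Fin (Module.finrank ℝ E)) ℝ E) (μ : Fin (Module.finrank ℝ E) → ℝ),
      ∀ i, T (b i) = μ i • b i := by
  let S : Set (Module.Dual ℝ E) := {f | ∃ μ : ℝ, ∀ y, f (T y) = μ * f y}
  have hspan : (⊤ : Submodule ℝ (Module.Dual ℝ E)) ≤ Submodule.span ℝ S := by
    rw [← Subspace.dualCoannihilator_dualAnnihilator_eq (W := Submodule.span ℝ S)]
    have : (Submodule.span ℝ S).dualCoannihilator = ⊥ := by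
      rw [eq_bot_iff]
      intro x hx
      rw [Submodule.mem_dualCoannihilator] at hx
      exact hT x fun f μ hf => hx f (Submodule.subset_span ⟨μ, hf⟩)
    rw [this, Submodule.dualAnnihilator_bot]
  let B := Module.Basis.ofSpan hspan
  have hB : ∀ i, B i ∈ S := fun i => Module.Basis.ofSpan_subset hspan ⟨i, rfl⟩
  choose μ hμ using hB
  have : Finite _ := Module.Finite.finite_basis B
  have := Fintype.ofFinite ((linearIndepOn_empty ℝ id).extend (Set.empty_subset S))
  classical
  let b := B.dualBasis.map (Module.evalEquiv ℝ E).symm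
  have hb : ∀ i j, B i (b j) = if i = j then 1 else 0 := by
    intro i j
    have : B i (b j) = B.dualBasis j (B i) := by
      simp only [b, Module.Basis.map_apply]
      exact Module.apply_evalEquiv_symm_apply ..
    rw [this, B.dualBasis_apply_self]
  have hTb : ∀ j, T (b j) = μ j • b j := by
    intro j
    rw [← sub_eq_zero]
    refine eq_zero_of_forall_dual fun f => ?_
    have : f ∈ Submodule.span ℝ (Set.range B) := by rw [B.span_eq]; trivial
    induction this using Submodule.span_induction with
    | mem f hf =>
      obtain ⟨i, rfl⟩ := hf
      rw [map_sub, hμ, map_smul, hb]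
      by_cases hij : i = j <;> simp [hij]
    | zero => rfl
    | add f g _ _ hf hg => simp only [LinearMap.add_apply, hf, hg, add_zero]
    | smul c f _ hf => simp only [LinearMap.smul_apply, hf, smul_zero]
  let e := Fintype.equivFinOfCardEq (Module.finrank_eq_card_basis b).symm
  exact ⟨b.reindex e, μ ∘ e.symm, fun i => by simp [hTb]⟩

end EigSep

/-! ### Continuous families of linear maps and of eigenbases -/

section ContinuousFamilies

variable {X E E' : Type*} [TopologicalSpace X]
  [AddCommGroup E] [Module ℝ E] [TopologicalSpace E] [IsTopologicalAddGroup E]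
  [ContinuousSMul ℝ E] [T2Space E] [FiniteDimensional ℝ E]
  [AddCommGroup E'] [Module ℝ E'] [TopologicalSpace E'] [IsTopologicalAddGroup E']
  [ContinuousSMul ℝ E']

/-- In finite dimension pointwise continuity of `Φ` is enough: the argument is expanded in a fixed
basis. -/
theorem ContinuousOn.linearFamily_apply {U : Set X} {Φ : X → E →ₗ[ℝ] E'} {x : X → E}
    (hΦ : ∀ y, ContinuousOn (fun s => Φ s y) U) (hx : ContinuousOn x U) :
    ContinuousOn (fun s => Φ s (x s)) U := by
  let b := Module.finBasis ℝ E
  have h : (fun s => Φ s (x s)) = fun s => ∑ i, b.coord i (x s) • Φ s (b i) := by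
    funext s
    conv_lhs => rw [← b.sum_repr (x s), map_sum]
    simp only [map_smul, Module.Basis.coord_apply]
  rw [h]
  refine continuousOn_finsetSum _ fun i _ => ContinuousOn.smul ?_ (hΦ _)
  exact (LinearMap.continuous_of_finiteDimensional (b.coord i)).comp_continuousOn hx

end ContinuousFamilies

section Eigenbases

variable {E G : Type*} [AddCommGroup E] [Module ℝ E] [TopologicalSpace E]
  [AddCommGroup G] [Module ℝ G]

theorem HasContinuousEigenbasis.eigSep {P : (Fin 3 → ℝ) → Module.End ℝ E}
    (h : HasContinuousEigenbasis P) {s : Fin 3 → ℝ} (hs : s ≠ 0) : EigSep (P s) := by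
  obtain ⟨U, hU, e, μ, -, he⟩ := h s hs
  exact EigSep.of_basis (e s) (μ s) (he s (mem_of_mem_nhds hU))

/-- Injectivity and equality of dimensions make `Ω s` an isomorphism, which carries one fixed basis
of `G` to an eigenbasis at each `s`. -/
theorem HasContinuousEigenbasis.of_frame [FiniteDimensional ℝ E]
    {P : (Fin 3 → ℝ) → Module.End ℝ E}
    (h : ∀ s₀ : Fin 3 → ℝ, s₀ ≠ 0 → ∃ U ∈ 𝓝 s₀, ∃ (ι : Type) (_ : Fintype ι)
      (b : Module.Basis ι ℝ G) (Ω : (Fin 3 → ℝ) → G →ₗ[ℝ] E) (μ : (Fin 3 → ℝ) → ι → ℝ),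
      Module.finrank ℝ G = Module.finrank ℝ E ∧
      (∀ i, ContinuousOn (fun s => Ω s (b i)) U) ∧
      ∀ s ∈ U, Function.Injective (Ω s) ∧ ∀ i, P s (Ω s (b i)) = μ s i • Ω s (b i)) :
    HasContinuousEigenbasis P := by
  intro s₀ hs₀
  obtain ⟨U, hU, ι, _, b, Ω, μ, hfin, hcont, hΩ⟩ := h s₀ hs₀
  have : FiniteDimensional ℝ G := Module.Finite.of_basis b
  let ε : ι ≃ Fin (Module.finrank ℝ E) :=
    Fintype.equivFinOfCardEq (by rw [← hfin, Module.finrank_eq_card_basis b])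
  classical
  -- A basis is demanded for all `s`; outside `U` an arbitrary one serves.
  let e : (Fin 3 → ℝ) → Module.Basis (Fin (Module.finrank ℝ E)) ℝ E := fun s =>
    if hs : s ∈ U then
      (b.map (LinearEquiv.ofInjectiveOfFinrankEq (Ω s) (hΩ s hs).1 hfin)).reindex ε
    else Module.finBasis ℝ E
  have he : ∀ s ∈ U, ∀ k, e s k = Ω s (b (ε.symm k)) := by
    intro s hs k
    simp only [e, dif_pos hs, Module.Basis.reindex_apply, Module.Basis.map_apply]
    rfl
  refine ⟨U, hU, e, fun s k => μ s (ε.symm k), fun k => ?_, fun s hs k => ?_⟩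
  · exact (hcont (ε.symm k)).congr fun s hs => he s hs k
  · rw [he s hs k]
    exact (hΩ s hs).2 _

/-- Near every `s₀ ≠ 0` the family `P s - (c · s)` is conjugate to a nonzero multiple of the fixed
endomorphism `D`, by means of isomorphisms that depend continuously on `s`. -/
def LocallyModelled (P : (Fin 3 → ℝ) → Module.End ℝ E) (c : Fin 3 → ℝ)
    (D : Module.End ℝ E) : Prop :=
  ∀ s₀ : Fin 3 → ℝ, s₀ ≠ 0 → ∃ U ∈ 𝓝 s₀, ∃ (Φ Ψ : (Fin 3 → ℝ) → E →ₗ[ℝ] E)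
    (k : (Fin 3 → ℝ) → ℝ),
    (∀ x, ContinuousOn (fun s => Φ s x) U) ∧ (∀ x, ContinuousOn (fun s => Ψ s x) U) ∧
    ContinuousOn k U ∧
    ∀ s ∈ U, k s ≠ 0 ∧ (∀ x, Ψ s (Φ s x) = x) ∧ (∀ x, Φ s (Ψ s x) = x) ∧
      ∀ x, P s (Φ s x) = (∑ i, s i * c i) • Φ s x + k s • Φ s (D x)

namespace LocallyModelled

variable {P : (Fin 3 → ℝ) → Module.End ℝ E} {c : Fin 3 → ℝ} {D : Module.End ℝ E}

/-- An eigenbasis of `D` does not depend on `s`, so only its transport by `Φ s` varies. -/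
theorem hasContinuousEigenbasis [FiniteDimensional ℝ E] (h : LocallyModelled P c D)
    (hD : EigSep D) : HasContinuousEigenbasis P := by
  obtain ⟨b, μ, hb⟩ := hD.exists_basis
  refine .of_frame (G := E) fun s₀ hs₀ => ?_
  obtain ⟨U, hU, Φ, Ψ, k, hΦ, -, -, H⟩ := h s₀ hs₀
  refine ⟨U, hU, _, inferInstance, b, Φ, fun s i => ∑ j, s j * c j + k s * μ i, rfl,
    fun i => hΦ _, fun s hs => ⟨fun x y hxy => ?_, fun i => ?_⟩⟩
  · rw [← (H s hs).2.1 x, hxy, (H s hs).2.1 y]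
  · rw [(H s hs).2.2.2, hb, map_smul, smul_smul, add_smul]

theorem eigSep (h : LocallyModelled P c D) {s : Fin 3 → ℝ} (hs : s ≠ 0) (hP : EigSep (P s)) :
    EigSep D := by
  obtain ⟨U, hU, Φ, Ψ, k, -, -, -, H⟩ := h s hs
  obtain ⟨hk, hΨΦ, -, H⟩ := H s (mem_of_mem_nhds hU)
  intro x hx
  have hinj : Function.Injective (Φ s) := fun x y hxy => by rw [← hΨΦ x, hxy, hΨΦ y]
  refine hinj ?_
  rw [map_zero]
  refine hP _ fun f μ hf => hx (f ∘ₗ Φ s) ((μ - ∑ i, s i * c i) / k s) fun y => ?_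
  have := hf (Φ s y)
  rw [H, map_add, map_smul, map_smul, smul_eq_mul, smul_eq_mul] at this
  simp only [LinearMap.comp_apply]
  field_simp
  linear_combination this

end LocallyModelled

end Eigenbases

/-! ### Second order systems and their first order reductions -/

namespace SecondOrderSystem

variable {V W : Type*} [AddCommGroup V] [Module ℝ V] [AddCommGroup W] [Module ℝ W]

theorem symbol_apply (S : SecondOrderSystem V W) (s : Fin 3 → ℝ) (x : V × W) :
    S.symbol s x = (∑ i, s i • S.A₁ i x.1 + S.A₂ x.2,
      ∑ i, ∑ j, (s i * s j) • S.B₁ i j x.1 + ∑ i, s i • S.B₂ i x.2) := by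
  simp [symbol]

/-- The values of `(v, d_i, w)` on a plane wave with covector `s`, without the component of `v`,
which is of lower order. -/
def planeWave (V W : Type*) [AddCommGroup V] [Module ℝ V] [AddCommGroup W] [Module ℝ W]
    (s : Fin 3 → ℝ) : V × W →ₗ[ℝ] V × (Fin 3 → V) × W where
  toFun x := (0, fun i => s i • x.1, x.2)
  map_add' x y := by ext <;> simp
  map_smul' r x := by ext <;> simp [smul_comm r]

theorem planeWave_injective {s : Fin 3 → ℝ} (hs : s ≠ 0) :
    Function.Injective (planeWave V W s) := by
  obtain ⟨i, hi⟩ := Function.ne_iff.1 hs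
  intro x y hxy
  simp only [planeWave, LinearMap.coe_mk, AddHom.coe_mk, Prod.mk.injEq, true_and] at hxy
  exact Prod.ext (smul_right_injective V hi (congrFun hxy.1 i)) hxy.2

/-- The defining identity of a reduction is evaluated at `h i j = s_i s_j v` and `ω i = s_i w`.
Hence plane waves are invariant for every reduction, whichever multiples of the constraints were
added. -/
theorem IsReduction.firstOrderSymbol_planeWave {S : SecondOrderSystem V W}
    {A : Fin 3 → Module.End ℝ (V × (Fin 3 → V) × W)} (hA : S.IsReduction A) (s : Fin 3 → ℝ)
    (x : V × W) :
    firstOrderSymbol A s (planeWave V W s x) = planeWave V W s (S.symbol s x) := by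
  have h := hA (fun i j => (s i * s j) • x.1) (fun i => s i • x.2)
    (fun i j => by rw [mul_comm])
  have h1 : firstOrderSymbol A s (planeWave V W s x) =
      ∑ p, A p (0, (fun j => (s p * s j) • x.1), s p • x.2) := by
    simp only [firstOrderSymbol, LinearMap.sum_apply, LinearMap.smul_apply, ← map_smul]
    refine Finset.sum_congr rfl fun p _ => ?_
    congr 1
    refine Prod.ext ?_ (Prod.ext ?_ rfl)
    · simp [planeWave]
    · funext j; simp [planeWave, smul_smul]
  rw [h1, h, symbol_apply]
  refine Prod.ext rfl (Prod.ext ?_ ?_)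
  · funext i
    simp [planeWave, smul_add, Finset.smul_sum, smul_smul]
  · simp [planeWave]

theorem IsStronglyHyperbolic.eigSep [TopologicalSpace V] [TopologicalSpace W]
    {S : SecondOrderSystem V W} (h : S.IsStronglyHyperbolic) {s : Fin 3 → ℝ} (hs : s ≠ 0) :
    EigSep (S.symbol s) := by
  obtain ⟨A, hA, hyp⟩ := h
  exact (HasContinuousEigenbasis.eigSep hyp hs).of_injective (planeWave V W s)
    (planeWave_injective hs) (hA.firstOrderSymbol_planeWave s)

/-- The reduction of `S` to first order in which all constraints that are not determined by `S`
are propagated with velocity `c`. -/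
def advectedReduction (S : SecondOrderSystem V W) (c : Fin 3 → ℝ) (p : Fin 3) :
    Module.End ℝ (V × (Fin 3 → V) × W) where
  toFun u :=
    (c p • u.1,
     fun i => (if i = p then ∑ j, (S.A₁ j (u.2.1 j) - c j • u.2.1 j) + S.A₂ u.2.2 else 0) +
       c p • u.2.1 i,
     ∑ j, S.B₁ p j (u.2.1 j) + S.B₂ p u.2.2)
  map_add' u u' := by
    refine Prod.ext (by simp) (Prod.ext (funext fun i => ?_) ?_)
    · by_cases h : i = p <;> simp [h, Finset.sum_add_distrib]
      abel
    · simp [Finset.sum_add_distrib]; abel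
  map_smul' r u := by
    refine Prod.ext (by simp [smul_comm r]) (Prod.ext (funext fun i => ?_) ?_)
    · by_cases h : i = p <;> simp [h, Finset.smul_sum, smul_add, smul_sub, smul_comm r]
    · simp [Finset.smul_sum]

theorem isReduction_advectedReduction (S : SecondOrderSystem V W) (c : Fin 3 → ℝ) :
    S.IsReduction (S.advectedReduction c) := by
  intro h ω hh
  refine Prod.ext ?_ (Prod.ext (funext fun i => ?_) ?_)
  · simp [advectedReduction, Prod.fst_sum]
  · simp only [advectedReduction, LinearMap.coe_mk, AddHom.coe_mk, Prod.snd_sum, Prod.fst_sum,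
      Finset.sum_apply, Finset.sum_add_distrib, Finset.sum_ite_eq, Finset.mem_univ, if_true,
      Finset.sum_sub_distrib]
    -- Symmetry of second derivatives cancels the advection term against the one subtracted in the
    -- equation for `d_i`.
    have : ∑ j, c j • h j i = ∑ j, c j • h i j := Finset.sum_congr rfl fun j _ => by rw [hh j i]
    rw [this]
    abel
  · simp [advectedReduction, Prod.snd_sum, Finset.sum_add_distrib]

/-- The source of the variables `(v, w)` that arises from a deviation `d_i` from a gradient. -/
def constraintSource (S : SecondOrderSystem V W) (c s : Fin 3 → ℝ) :
    (Fin 3 → V) →ₗ[ℝ] V × W where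
  toFun d := (∑ j, (S.A₁ j (d j) - c j • d j), ∑ p, s p • ∑ j, S.B₁ p j (d j))
  map_add' d d' := by
    refine Prod.ext ?_ (by simp [Finset.sum_add_distrib])
    simp [Finset.sum_add_distrib]
    abel
  map_smul' r d := by
    refine Prod.ext ?_ ?_ <;> simp [Finset.smul_sum, smul_sub, smul_comm r]

/-- Up to the scalar `s · c` the symbol takes values in the plane waves. Modulo these, every
variable is therefore advected with the same eigenvalue. -/
theorem firstOrderSymbol_advectedReduction (S : SecondOrderSystem V W) (c s : Fin 3 → ℝ)
    (u : V × (Fin 3 → V) × W) :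
    firstOrderSymbol (S.advectedReduction c) s u = (∑ i, s i * c i) • u +
      planeWave V W s (S.constraintSource c s u.2.1 +
        (S.A₂ u.2.2, ∑ p, s p • S.B₂ p u.2.2 - (∑ i, s i * c i) • u.2.2)) := by
  refine Prod.ext ?_ (Prod.ext (funext fun i => ?_) ?_)
  · simp [firstOrderSymbol, advectedReduction, planeWave, Prod.fst_sum, Finset.sum_smul, smul_smul]
  · simp only [firstOrderSymbol, advectedReduction, planeWave, constraintSource,
      LinearMap.sum_apply, LinearMap.smul_apply, LinearMap.coe_mk, AddHom.coe_mk, Prod.snd_sum,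
      Prod.fst_sum, Finset.sum_apply, Prod.smul_fst, Prod.smul_snd, Prod.fst_add, Prod.snd_add,
      Pi.smul_apply, Pi.add_apply, smul_add, smul_ite, smul_zero, Finset.sum_add_distrib,
      Finset.sum_ite_eq, Finset.mem_univ, if_true, Finset.sum_smul, smul_smul]
    abel
  · simp only [firstOrderSymbol, advectedReduction, planeWave, constraintSource,
      LinearMap.sum_apply, LinearMap.smul_apply, LinearMap.coe_mk, AddHom.coe_mk, Prod.snd_sum,
      Prod.smul_snd, Prod.snd_add, smul_add, Finset.sum_add_distrib]
    abel

section

variable [TopologicalSpace V] [IsTopologicalAddGroup V] [ContinuousSMul ℝ V] [T2Space V]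
  [FiniteDimensional ℝ V] [TopologicalSpace W] [IsTopologicalAddGroup W] [ContinuousSMul ℝ W]
  [T2Space W] [FiniteDimensional ℝ W]

/-- Plane waves contribute the eigenvectors of `D`. A constraint violating vector is an eigenvector
for `s · c` up to a plane wave source, which is removed by inverting `S.symbol s - s · c` on plane
waves. This needs the inverse `D'` of `D`. -/
theorem isStronglyHyperbolic_of_locallyModelled {S : SecondOrderSystem V W} {c : Fin 3 → ℝ}
    {D D' : Module.End ℝ (V × W)} (h : LocallyModelled S.symbol c D) (hD : EigSep D)
    (hD' : ∀ x, D (D' x) = x) : S.IsStronglyHyperbolic := by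
  refine ⟨S.advectedReduction c, S.isReduction_advectedReduction c, ?_⟩
  obtain ⟨b, μ, hb⟩ := hD.exists_basis
  refine .of_frame (G := (V × W) × (Fin 3 → V)) fun s₀ hs₀ => ?_
  obtain ⟨i₀, hi₀⟩ := Function.ne_iff.1 hs₀
  obtain ⟨U, hU, Φ, Ψ, k, hΦ, hΨ, hk, H⟩ := h s₀ hs₀
  -- Where `s i₀ ≠ 0`, the vectors `d` with `d i₀ = 0` are a complement to the gradients `s_i v`.
  -- The unused entry `d i₀` will parametrize the variable `v` itself.
  let proj : (Fin 3 → V) →ₗ[ℝ] (Fin 3 → V) :=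
    LinearMap.pi fun i => if i = i₀ then 0 else LinearMap.proj i
  have proj_self : ∀ d, proj d i₀ = 0 := fun d => by simp [proj]
  have proj_ne : ∀ d i, i ≠ i₀ → proj d i = d i := fun d i hi => by simp [proj, hi]
  -- The resolvent of the second order symbol at the value `s · c`.
  let R : (Fin 3 → ℝ) → (V × W) →ₗ[ℝ] (V × W) := fun s => (k s)⁻¹ • (Φ s ∘ₗ D' ∘ₗ Ψ s)
  have hR : ∀ s ∈ U, ∀ x, S.symbol s (R s x) = (∑ i, s i * c i) • R s x + x := by
    intro s hs x
    obtain ⟨hk0, -, h2, h3⟩ := H s hs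
    simp only [R, LinearMap.smul_apply, LinearMap.comp_apply, map_smul, h3, hD', h2, smul_add,
      smul_smul]
    rw [inv_mul_cancel₀ hk0, one_smul, mul_comm]
  -- The second summand corrects each constraint mode by the plane wave that cancels its source.
  let Ω : (Fin 3 → ℝ) → (V × W) × (Fin 3 → V) →ₗ[ℝ] V × (Fin 3 → V) × W := fun s =>
    LinearMap.coprod (planeWave V W s ∘ₗ Φ s)
      (LinearMap.prod (LinearMap.proj i₀) (LinearMap.prod proj 0) -
        planeWave V W s ∘ₗ R s ∘ₗ S.constraintSource c s ∘ₗ proj)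
  have hΩ : ∀ s x d, Ω s (x, d) = planeWave V W s (Φ s x) +
      ((d i₀, proj d, 0) - planeWave V W s (R s (S.constraintSource c s (proj d)))) :=
    fun s x d => rfl
  have hplane : ∀ s x, firstOrderSymbol (S.advectedReduction c) s (planeWave V W s x) =
      planeWave V W s (S.symbol s x) :=
    fun s x => (S.isReduction_advectedReduction c).firstOrderSymbol_planeWave s x
  have hU' : U ∩ {s | s i₀ ≠ 0} ∈ 𝓝 s₀ :=
    Filter.inter_mem hU ((isOpen_ne.preimage (continuous_apply i₀)).mem_nhds hi₀)
  have hpw : ∀ {y : (Fin 3 → ℝ) → V × W} {A : Set (Fin 3 → ℝ)}, ContinuousOn y A →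
      ContinuousOn (fun s => planeWave V W s (y s)) A := by
    intro y A hy
    refine ContinuousOn.linearFamily_apply (fun x => ?_) hy
    refine Continuous.continuousOn ?_
    simp only [planeWave, LinearMap.coe_mk, AddHom.coe_mk]
    fun_prop
  refine ⟨U ∩ {s | s i₀ ≠ 0}, hU', _, inferInstance,
    b.prod (Pi.basis fun _ : Fin 3 => Module.finBasis ℝ V), Ω,
    fun s => Sum.elim (fun i => ∑ j, s j * c j + k s * μ i) fun _ => ∑ j, s j * c j, ?_, ?_, ?_⟩
  · simp only [Module.finrank_prod, Module.finrank_pi_fintype]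
    ring
  · rintro (i | i)
    · simp only [Module.Basis.prod_apply, Sum.elim_inl, Function.comp_apply, LinearMap.inl_apply,
        hΩ, map_zero, sub_zero, Pi.zero_apply]
      simp only [Prod.mk_zero_zero, add_zero]
      exact hpw ((hΦ _).mono Set.inter_subset_left)
    · simp only [Module.Basis.prod_apply, Sum.elim_inr, Function.comp_apply, LinearMap.inr_apply,
        hΩ, map_zero, zero_add]
      refine continuousOn_const.sub (hpw ?_)
      refine ContinuousOn.linearFamily_apply (fun x => ?_) ?_
      · simp only [R, LinearMap.smul_apply, LinearMap.comp_apply]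
        refine ContinuousOn.mono ?_ Set.inter_subset_left
        refine (hk.inv₀ fun s hs => (H s hs).1).smul ?_
        refine ContinuousOn.linearFamily_apply hΦ ?_
        exact (LinearMap.continuous_of_finiteDimensional D').comp_continuousOn (hΨ x)
      · refine Continuous.continuousOn ?_
        simp only [constraintSource, LinearMap.coe_mk, AddHom.coe_mk]
        fun_prop
  · rintro s ⟨hs, hsi⟩
    obtain ⟨hk0, h1, h2, h3⟩ := H s hs
    refine ⟨?_, ?_⟩
    · rw [← LinearMap.ker_eq_bot, LinearMap.ker_eq_bot']
      rintro ⟨x, d⟩ hxd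
      rw [hΩ] at hxd
      have hpl : ∀ y : V × W, planeWave V W s y = (0, fun i => s i • y.1, y.2) := fun _ => rfl
      set y := R s (S.constraintSource c s (proj d)) with hy
      have e1 : d i₀ = 0 := by simpa [hpl] using congrArg Prod.fst hxd
      have e2 : ∀ i, s i • (Φ s x).1 + (proj d i - s i • y.1) = 0 := fun i => by
        simpa [hpl] using congrFun (congrArg (fun u => u.2.1) hxd) i
      have e3 : (Φ s x).2 - y.2 = 0 := by
        have := congrArg (fun u => u.2.2) hxd
        simpa [hpl, sub_eq_add_neg] using this
      have e4 : (Φ s x).1 - y.1 = 0 := by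
        have := e2 i₀
        rw [proj_self, zero_sub, ← sub_eq_add_neg, ← smul_sub] at this
        exact (smul_eq_zero.1 this).resolve_left hsi
      have e5 : proj d = 0 := by
        funext i
        have := e2 i
        rw [sub_eq_zero.1 e4] at this
        simpa using this
      have e6 : d = 0 := by
        funext i
        by_cases hi : i = i₀
        · rw [hi, e1]; rfl
        · rw [← proj_ne d i hi, e5]
      have e7 : y = 0 := by rw [hy, e5, map_zero, map_zero]
      have e8 : Φ s x = 0 := by
        rw [e7] at e3 e4
        exact Prod.ext (by simpa using e4) (by simpa using e3)
      rw [e6, ← h1 x, e8, map_zero]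
      rfl
    · rintro (i | i)
      · simp only [Module.Basis.prod_apply, Sum.elim_inl, Function.comp_apply, LinearMap.inl_apply,
          hΩ, map_zero, sub_zero, Pi.zero_apply, Prod.mk_zero_zero, add_zero]
        rw [hplane, h3, hb, map_smul, smul_smul, ← add_smul, map_smul]
      · simp only [Module.Basis.prod_apply, Sum.elim_inr, Function.comp_apply, LinearMap.inr_apply,
          hΩ, map_zero, zero_add]
        rw [map_sub, hplane, hR s hs, firstOrderSymbol_advectedReduction]
        simp only [map_add, map_smul, map_zero, smul_zero, Finset.sum_const_zero, sub_zero,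
          Prod.mk_zero_zero, add_zero, smul_sub]
        abel

end

end SecondOrderSystem

/-- A continuous invertible intertwiner is absorbed into `Φ`, without changing `c`, `D` or the
factor `k`. -/
theorem LocallyModelled.conj {E : Type*} [AddCommGroup E] [Module ℝ E] [TopologicalSpace E]
    [IsTopologicalAddGroup E] [ContinuousSMul ℝ E] [T2Space E] [FiniteDimensional ℝ E]
    {P P' : (Fin 3 → ℝ) → Module.End ℝ E} {c : Fin 3 → ℝ} {D : Module.End ℝ E}
    (h : LocallyModelled P c D) (Θ Θ' : (Fin 3 → ℝ) → E →ₗ[ℝ] E)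
    (hΘ : ∀ x, Continuous fun s => Θ s x) (hΘ' : ∀ x, Continuous fun s => Θ' s x)
    (h1 : ∀ s x, Θ' s (Θ s x) = x) (h2 : ∀ s x, Θ s (Θ' s x) = x)
    (hP : ∀ s x, P' s (Θ s x) = Θ s (P s x)) : LocallyModelled P' c D := by
  intro s₀ hs₀
  obtain ⟨U, hU, Φ, Ψ, k, hΦ, hΨ, hk, H⟩ := h s₀ hs₀
  refine ⟨U, hU, fun s => Θ s ∘ₗ Φ s, fun s => Ψ s ∘ₗ Θ' s, k, fun x => ?_, fun x => ?_, hk,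
    fun s hs => ⟨(H s hs).1, fun x => ?_, fun x => ?_, fun x => ?_⟩⟩
  · exact ContinuousOn.linearFamily_apply (Φ := Θ) (fun y => (hΘ y).continuousOn) (hΦ x)
  · exact ContinuousOn.linearFamily_apply (Φ := Ψ) hΨ (hΘ' x).continuousOn
  · simp only [LinearMap.comp_apply, h1, (H s hs).2.1]
  · simp only [LinearMap.comp_apply, h2, (H s hs).2.2.1]
  · simp only [LinearMap.comp_apply, hP, (H s hs).2.2.2, map_add, map_smul]

/-! ### From canonical variables to velocities -/

namespace HamiltonianGR

open Background

/-- Contraction with the symmetric `s_i s_j` undoes the symmetrization of `F†ⁱ M Fʲ`, leaving a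
product of contracted blocks. -/
theorem fullySecondOrderForm_symbol_apply (C : Parameters) (b : Background) (s : Fin 3 → ℝ)
    (x : Fields × Fields) :
    (fullySecondOrderForm C b).symbol s x = (x.2,
      Minv C b ((∑ i, ∑ j, (s i * s j) • V b i j) x.1) -
        Minv C b ((∑ i, s i • Fdag C b i) (M C b ((∑ i, s i • F C b i) x.1))) +
      ((∑ i, s i • F C b i) (Minv C b (M C b x.2)) +
        Minv C b ((∑ i, s i • Fdag C b i) (M C b x.2)))) := by
  have e : ∑ i, ∑ j, (s i * s j) • (Minv C b * (V b i j - (1 / 2 : ℝ) •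
        (Fdag C b i * M C b * F C b j + Fdag C b j * M C b * F C b i))) =
      Minv C b * (∑ i, ∑ j, (s i * s j) • V b i j) -
        Minv C b * ((∑ i, s i • Fdag C b i) * (M C b * (∑ i, s i • F C b i))) := by
    refine LinearMap.ext fun q => ?_
    simp only [Fin.sum_univ_three, LinearMap.add_apply, LinearMap.sub_apply,
      LinearMap.smul_apply, Module.End.mul_apply, map_add, map_sub, map_smul]
    module
  have e' : ∑ i, s i • ((F C b i * Minv C b + Minv C b * Fdag C b i) * M C b) =
      (∑ i, s i • F C b i) * (Minv C b * M C b) +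
        Minv C b * ((∑ i, s i • Fdag C b i) * M C b) := by
    simp only [Fin.sum_univ_three, mul_add, add_mul, smul_mul_assoc, mul_smul_comm,
      smul_add, mul_assoc]
    module
  rw [SecondOrderSystem.symbol]
  simp only [fullySecondOrderForm, fullySecondOrderSystem, e, e']
  simp [Module.End.mul_apply]

theorem canonicalSystem_symbol_apply (C : Parameters) (b : Background) (s : Fin 3 → ℝ)
    (x : Fields × Fields) :
    (canonicalSystem C b).symbol s x = ((∑ i, s i • F C b i) x.1 + Minv C b x.2,
      (∑ i, ∑ j, (s i * s j) • V b i j) x.1 + (∑ i, s i • Fdag C b i) x.2) := rfl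

/-- The passage from canonical variables `(q, p)` to `(q, ∂_t q)` on plane waves. -/
def toVelocity (C : Parameters) (b : Background) (s : Fin 3 → ℝ) :
    Fields × Fields →ₗ[ℝ] Fields × Fields :=
  LinearMap.prod (LinearMap.fst ℝ _ _)
    (LinearMap.coprod (∑ i, s i • F C b i) (Minv C b))

/-- The passage from `(q, ∂_t q)` to canonical variables `(q, p)` on plane waves. -/
def ofVelocity (C : Parameters) (b : Background) (s : Fin 3 → ℝ) :
    Fields × Fields →ₗ[ℝ] Fields × Fields :=
  LinearMap.prod (LinearMap.fst ℝ _ _)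
    (M C b ∘ₗ LinearMap.coprod (-∑ i, s i • F C b i) LinearMap.id)

theorem toVelocity_apply (C : Parameters) (b : Background) (s : Fin 3 → ℝ) (x : Fields × Fields) :
    toVelocity C b s x = (x.1, (∑ i, s i • F C b i) x.1 + Minv C b x.2) := rfl

theorem ofVelocity_apply (C : Parameters) (b : Background) (s : Fin 3 → ℝ) (x : Fields × Fields) :
    ofVelocity C b s x = (x.1, M C b (-(∑ i, s i • F C b i) x.1 + x.2)) := rfl

theorem LocallyModelled.fullySecondOrderForm {C : Parameters} {b : Background}
    (hM : IsUnit (Minv C b)) {c : Fin 3 → ℝ} {D : Module.End ℝ (Fields × Fields)}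
    (h : LocallyModelled (canonicalSystem C b).symbol c D) :
    LocallyModelled (fullySecondOrderForm C b).symbol c D := by
  have hM1 : ∀ y, M C b (Minv C b y) = y := fun y => by
    rw [← Module.End.mul_apply, M, Ring.inverse_mul_cancel _ hM]; rfl
  have hM2 : ∀ y, Minv C b (M C b y) = y := fun y => by
    rw [← Module.End.mul_apply, M, Ring.mul_inverse_cancel _ hM]; rfl
  have hc : Continuous (M C b) := LinearMap.continuous_of_finiteDimensional _
  refine LocallyModelled.conj h (toVelocity C b) (ofVelocity C b) (fun x => ?_) (fun x => ?_)
    (fun s x => ?_) (fun s x => ?_) (fun s x => ?_)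
  · simp only [toVelocity_apply, LinearMap.sum_apply, LinearMap.smul_apply]
    fun_prop
  · simp only [ofVelocity_apply, LinearMap.sum_apply, LinearMap.smul_apply]
    fun_prop
  · simp only [toVelocity_apply, ofVelocity_apply, neg_add_cancel_left, hM1]
  · simp only [toVelocity_apply, ofVelocity_apply, hM2, add_neg_cancel_left]
  · rw [fullySecondOrderForm_symbol_apply, canonicalSystem_symbol_apply, toVelocity_apply,
      toVelocity_apply]
    simp only [map_add, hM1, hM2]
    refine Prod.ext rfl ?_
    simp only
    abel

/-! ### Orthonormal frames adapted to a covector -/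

section PosDef

open scoped MatrixOrder Matrix.Norms.L2Operator

theorem exists_eq_transpose_mul_self {n : ℕ} {γ : Matrix (Fin n) (Fin n) ℝ} (h : γ.PosDef) :
    ∃ B : Matrix (Fin n) (Fin n) ℝ, IsUnit B ∧ γ = Bᵀ * B := by
  obtain ⟨B, hB, e⟩ :=
    CStarAlgebra.isStrictlyPositive_iff_eq_star_mul_self.mp h.isStrictlyPositive
  refine ⟨B, hB, ?_⟩
  rw [e, Matrix.star_eq_conjTranspose, Matrix.conjTranspose_eq_transpose_of_trivial]

end PosDef

/-- The columns of `N` form an orthonormal basis for the spatial metric, `L` is the inverse of `N`,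
and the covector `s` is `k` times the first element of the dual basis. -/
structure IsAdaptedFrame (b : Background) (s : Fin 3 → ℝ) (L N : Matrix (Fin 3) (Fin 3) ℝ)
    (k : ℝ) : Prop where
  L_mul_N : L * N = 1
  N_mul_L : N * L = 1
  γ_eq : b.γ = Lᵀ * L
  inv_eq : b.inv = N * Nᵀ
  k_ne_zero : k ≠ 0
  vecMul_eq : s ᵥ* N = Pi.single 0 k

/-- The reflection of Euclidean space in the direction `u`. -/
def householder (u : Fin 3 → ℝ) : Matrix (Fin 3) (Fin 3) ℝ :=
  1 - (2 / (u ⬝ᵥ u)) • Matrix.vecMulVec u u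

theorem householder_transpose (u : Fin 3 → ℝ) : (householder u)ᵀ = householder u := by
  simp [householder, Matrix.transpose_vecMulVec]

theorem householder_mul_self {u : Fin 3 → ℝ} (hu : u ⬝ᵥ u ≠ 0) :
    householder u * householder u = 1 := by
  have h : Matrix.vecMulVec u u * Matrix.vecMulVec u u = (u ⬝ᵥ u) • Matrix.vecMulVec u u := by
    rw [Matrix.vecMulVec_mul_vecMulVec]
    ext i j
    simp [Matrix.vecMulVec_apply]
    ring
  simp only [householder, mul_sub, sub_mul, one_mul, mul_one, smul_mul_assoc, mul_smul_comm, h,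
    smul_smul]
  rw [div_mul_cancel₀ _ hu]
  module

/-- With `γ = BᵀB` the problem becomes Euclidean for `t = s B⁻¹`. The reflection along `u = t + κ
e₀`, where `|κ| = |t|`, sends `t` to `-κ e₀` and depends continuously on `s` as long as `u ≠ 0`. -/
theorem exists_isAdaptedFrame (b : Background) {s₀ : Fin 3 → ℝ} (hs₀ : s₀ ≠ 0) :
    ∃ U ∈ 𝓝 s₀, ∃ (L N : (Fin 3 → ℝ) → Matrix (Fin 3) (Fin 3) ℝ) (k : (Fin 3 → ℝ) → ℝ),
      ContinuousOn L U ∧ ContinuousOn N U ∧ ContinuousOn k U ∧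
      ∀ s ∈ U, IsAdaptedFrame b s (L s) (N s) (k s) := by
  obtain ⟨B, hB, hγ⟩ := exists_eq_transpose_mul_self b.γ_posDef
  have hB' : IsUnit B.det := (Matrix.isUnit_iff_isUnit_det B).1 hB
  let t : (Fin 3 → ℝ) → Fin 3 → ℝ := fun s => s ᵥ* B⁻¹
  have ht₀ : t s₀ ≠ 0 := by
    intro h
    refine hs₀ ?_
    have := congrArg (· ᵥ* B) h
    simpa [t, Matrix.vecMul_vecMul, Matrix.nonsing_inv_mul _ hB'] using this
  have hpos : ∀ x : Fin 3 → ℝ, 0 ≤ x ⬝ᵥ x := fun x =>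
    Finset.sum_nonneg fun i _ => mul_self_nonneg (x i)
  have htpos : 0 < √(t s₀ ⬝ᵥ t s₀) :=
    Real.sqrt_pos.2 (lt_of_le_of_ne (hpos _) fun h => ht₀ (dotProduct_self_eq_zero.1 h.symm))
  -- With this sign, fixed by `s₀`, `κ` and the first component of `t` do not cancel at `s₀`, so `u
  -- s₀ ≠ 0`.
  let σ : ℝ := if 0 ≤ t s₀ 0 then 1 else -1
  have hσ : σ * σ = 1 := by simp only [σ]; split_ifs <;> norm_num
  let κ : (Fin 3 → ℝ) → ℝ := fun s => σ * √(t s ⬝ᵥ t s)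
  have hκ : ∀ s, κ s * κ s = t s ⬝ᵥ t s := fun s => by
    rw [mul_mul_mul_comm, hσ, one_mul, Real.mul_self_sqrt (hpos _)]
  let u : (Fin 3 → ℝ) → Fin 3 → ℝ := fun s => t s + Pi.single 0 (κ s)
  have hu : ∀ s, u s ⬝ᵥ u s = 2 * (κ s * (κ s + t s 0)) := fun s => by
    simp only [u, add_dotProduct, dotProduct_add, ← hκ, dotProduct_single, single_dotProduct,
      Pi.add_apply, Pi.single_eq_same]
    ring
  have hut : ∀ s, u s ⬝ᵥ t s = κ s * (κ s + t s 0) := fun s => by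
    simp only [u, add_dotProduct, ← hκ, single_dotProduct]
    ring
  have htc : Continuous t := by
    simp only [t]
    fun_prop
  have hκc : Continuous κ := by
    simp only [κ]
    fun_prop
  have huc : Continuous u := by
    refine htc.add (continuous_pi fun i => ?_)
    by_cases hi : i = 0
    · subst hi; simpa using hκc
    · simpa [Pi.single_eq_of_ne hi] using continuous_const
  have huuc : Continuous fun s => u s ⬝ᵥ u s := huc.dotProduct huc
  have hu₀ : u s₀ ⬝ᵥ u s₀ ≠ 0 := by
    rw [hu]
    by_cases h : 0 ≤ t s₀ 0
    · have e : κ s₀ = √(t s₀ ⬝ᵥ t s₀) := by simp [κ, σ, h]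
      rw [e]
      positivity
    · have e : κ s₀ = -√(t s₀ ⬝ᵥ t s₀) := by simp [κ, σ, h]
      rw [e]
      have : -√(t s₀ ⬝ᵥ t s₀) + t s₀ 0 < 0 := by linarith [not_le.1 h]
      exact mul_ne_zero two_ne_zero (mul_ne_zero (neg_ne_zero.2 htpos.ne') this.ne)
  have hRc : ContinuousOn (fun s => householder (u s)) {s | u s ⬝ᵥ u s ≠ 0} := by
    have h1 : ContinuousOn (fun s => 2 / (u s ⬝ᵥ u s)) {s | u s ⬝ᵥ u s ≠ 0} :=
      continuousOn_const.div huuc.continuousOn fun s hs => hs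
    exact ContinuousOn.sub continuousOn_const
      (ContinuousOn.smul h1 (huc.matrix_vecMulVec huc).continuousOn)
  refine ⟨{s | u s ⬝ᵥ u s ≠ 0}, (isOpen_ne.preimage huuc).mem_nhds hu₀,
    fun s => householder (u s) * B, fun s => B⁻¹ * householder (u s), fun s => -κ s,
    ?_, ?_, hκc.neg.continuousOn, fun s hs => ?_⟩
  · exact (continuous_id.matrix_mul continuous_const).comp_continuousOn hRc
  · exact (continuous_const.matrix_mul continuous_id).comp_continuousOn hRc
  · have hR := householder_mul_self hs
    refine ⟨?_, ?_, ?_, ?_, ?_, ?_⟩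
    · rw [Matrix.mul_assoc, Matrix.mul_nonsing_inv_cancel_left _ _ hB', hR]
    · rw [Matrix.mul_assoc, ← Matrix.mul_assoc (householder _) (householder _), hR,
        Matrix.one_mul, Matrix.nonsing_inv_mul _ hB']
    · rw [Matrix.transpose_mul, householder_transpose, Matrix.mul_assoc,
        ← Matrix.mul_assoc (householder _) (householder _), hR, Matrix.one_mul, hγ]
    · rw [Matrix.transpose_mul, householder_transpose, Matrix.mul_assoc,
        ← Matrix.mul_assoc (householder _) (householder _), hR, Matrix.one_mul, inv, hγ,
        Matrix.mul_inv_rev, Matrix.transpose_nonsing_inv]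
    · intro h
      refine hs ?_
      rw [hu, neg_eq_zero.1 h, zero_mul, mul_zero]
    · rw [← Matrix.vecMul_vecMul]
      change t s ᵥ* householder (u s) = _
      rw [householder, Matrix.vecMul_sub, Matrix.vecMul_one, Matrix.vecMul_smul,
        Matrix.vecMul_vecMulVec, smul_smul, dotProduct_comm (t s), hut]
      have : 2 / (u s ⬝ᵥ u s) * (κ s * (κ s + t s 0)) = 1 := by
        have hs' : u s ⬝ᵥ u s ≠ 0 := hs
        rw [hu] at hs' ⊢
        rw [div_mul_eq_mul_div, div_self hs']
      rw [this, one_smul, Pi.single_neg]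
      simp [u]

/-- The action `h ↦ A h Aᵀ` on symmetric tensors. -/
def SymTensor.congr (A : Matrix (Fin 3) (Fin 3) ℝ) : SymTensor →ₗ[ℝ] SymTensor where
  toFun h := ⟨A * h.1 * Aᵀ, by
    have : h.1ᵀ = h.1 := h.2
    change (A * h.1 * Aᵀ)ᵀ = _
    simp [Matrix.transpose_mul, this, Matrix.mul_assoc]⟩
  map_add' h h' := Subtype.ext (by simp [Matrix.mul_add, Matrix.add_mul])
  map_smul' r h := Subtype.ext (by simp)

theorem SymTensor.coe_congr (A : Matrix (Fin 3) (Fin 3) ℝ) (h : SymTensor) :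
    (SymTensor.congr A h).1 = A * h.1 * Aᵀ := rfl

theorem SymTensor.congr_congr {A B : Matrix (Fin 3) (Fin 3) ℝ} (hAB : A * B = 1) (h : SymTensor) :
    SymTensor.congr A (SymTensor.congr B h) = h := by
  refine Subtype.ext ?_
  rw [coe_congr, coe_congr, Matrix.mul_assoc, Matrix.mul_assoc (B * h.1), ← Matrix.transpose_mul,
    hAB, Matrix.transpose_one, Matrix.mul_one, ← Matrix.mul_assoc, hAB, Matrix.one_mul]

/-- Positions and momenta with given components in a frame, up to factors `x`, `y`, `z`. -/
def frameMap (L N : Matrix (Fin 3) (Fin 3) ℝ) (x y z : ℝ) :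
    Fields × Fields →ₗ[ℝ] Fields × Fields where
  toFun f := ((SymTensor.congr Lᵀ f.1.1, x * f.1.2.1, x • N *ᵥ f.1.2.2),
    (y • SymTensor.congr N f.2.1, z * f.2.2.1, z • Lᵀ *ᵥ f.2.2.2))
  map_add' f f' := by
    simp only [Prod.fst_add, Prod.snd_add, map_add, mul_add, Matrix.mulVec_add, smul_add,
      Prod.mk_add_mk]
  map_smul' r f := by
    simp only [Prod.smul_fst, Prod.smul_snd, map_smul, smul_eq_mul, Matrix.mulVec_smul,
      RingHom.id_apply, Prod.smul_mk, smul_comm r, mul_left_comm r]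

theorem frameMap_frameMap {L N : Matrix (Fin 3) (Fin 3) ℝ} (h1 : L * N = 1)
    {x y z : ℝ} (hx : x ≠ 0) (hy : y ≠ 0) (hz : z ≠ 0) (f : Fields × Fields) :
    frameMap N L x⁻¹ y⁻¹ z⁻¹ (frameMap L N x y z f) = f := by
  have h1' : Nᵀ * Lᵀ = 1 := by rw [← Matrix.transpose_mul, h1, Matrix.transpose_one]
  simp only [frameMap, LinearMap.coe_mk, AddHom.coe_mk, SymTensor.congr_congr h1', map_smul,
    SymTensor.congr_congr h1, Matrix.mulVec_smul, Matrix.mulVec_mulVec, h1, h1', smul_smul,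
    Matrix.one_mulVec, inv_mul_cancel₀ hx, inv_mul_cancel₀ hy, inv_mul_cancel₀ hz, one_smul,
    inv_mul_cancel_left₀ hx, inv_mul_cancel_left₀ hz]

theorem continuousOn_frameMap {X : Type*} [TopologicalSpace X] {U : Set X}
    {L N : X → Matrix (Fin 3) (Fin 3) ℝ} {x y z : X → ℝ} (hL : ContinuousOn L U)
    (hN : ContinuousOn N U) (hx : ContinuousOn x U) (hy : ContinuousOn y U)
    (hz : ContinuousOn z U) (f : Fields × Fields) :
    ContinuousOn (fun s => frameMap (L s) (N s) (x s) (y s) (z s) f) U := by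
  have hcongr : ∀ {A : X → Matrix (Fin 3) (Fin 3) ℝ} (h : SymTensor), ContinuousOn A U →
      ContinuousOn (fun s => SymTensor.congr (A s) h) U := by
    intro A h hA
    have : Continuous fun B : Matrix (Fin 3) (Fin 3) ℝ => SymTensor.congr B h :=
      Continuous.subtype_mk (by fun_prop) _
    exact this.comp_continuousOn hA
  have hvec : ∀ {A : X → Matrix (Fin 3) (Fin 3) ℝ} (v : Fin 3 → ℝ), ContinuousOn A U →
      ContinuousOn (fun s => A s *ᵥ v) U := by
    intro A v hA
    have : Continuous fun B : Matrix (Fin 3) (Fin 3) ℝ => B *ᵥ v := by fun_prop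
    exact this.comp_continuousOn hA
  have hLt : ContinuousOn (fun s => (L s)ᵀ) U :=
    (continuous_id.matrix_transpose).comp_continuousOn hL
  simp only [frameMap, LinearMap.coe_mk, AddHom.coe_mk]
  exact ((hcongr _ hLt).prodMk ((hx.mul continuousOn_const).prodMk (hx.smul (hvec _ hN)))).prodMk
    ((hy.smul (hcongr _ hN)).prodMk ((hz.mul continuousOn_const).prodMk (hz.smul (hvec _ hLt))))

/-! ### The symbol in an adapted frame -/

/-- The principal symbol in an adapted frame, where the metric is the Euclidean metric, the
covector is the first element of the dual basis, the lapse is one and the shift is zero. -/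
def frameSymbol (C : Parameters) : Module.End ℝ (Fields × Fields) where
  toFun f :=
    ((SymTensor.mk (fun i j => 2 * f.2.1.1 i j +
          ((if i = 0 then f.1.2.2 j else 0) + (if j = 0 then f.1.2.2 i else 0)) -
          (if i = j then f.2.1.1.trace + (1 / 2 + C.C₁) * f.2.2.1 else 0))
        (fun i j => by
          rw [symTensor_symm, add_comm (ite _ _ _)]
          simp only [eq_comm (a := i)]),
      C.C₇ * f.1.2.2 0 - (1 / 2 + C.C₁) * f.2.1.1.trace + (1 / 4 + 2 * C.C₄) * f.2.2.1,
      fun i => (1 + C.C₂) * f.1.1.1 0 i - (1 + 2 * C.C₆) * f.2.2.2 i -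
        if i = 0 then 1 / 2 * (C.C₂ - C.C₃ + 1) * f.1.1.1.trace + (1 + C.C₅) * f.1.2.1 else 0),
     (SymTensor.mk (fun i j => 1 / 2 * f.1.1.1 i j +
          ((if i = 0 then (1 + C.C₂) * f.2.2.2 j - f.1.1.1 0 j else 0) +
            (if j = 0 then (1 + C.C₂) * f.2.2.2 i - f.1.1.1 0 i else 0)) / 2 +
          (if i = 0 then if j = 0 then 1 / 2 * f.1.1.1.trace + f.1.2.1 else 0 else 0) +
          (if i = j then 1 / 2 * (f.1.1.1 0 0 - f.1.1.1.trace) - f.1.2.1 -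
            1 / 2 * (C.C₂ - C.C₃ + 1) * f.2.2.2 0 else 0))
        (fun i j => by
          rw [symTensor_symm, add_comm (ite _ _ _)]
          simp only [eq_comm (a := i)]
          congr 2
          split_ifs <;> rfl),
      f.1.1.1 0 0 - f.1.1.1.trace - (1 + C.C₅) * f.2.2.2 0,
      fun i => 2 * f.2.1.1 0 i + if i = 0 then C.C₇ * f.2.2.1 else 0))
  map_add' f f' := by
    refine Prod.ext (Fields.ext (fun i j => ?_) ?_ fun i => ?_)
      (Fields.ext (fun i j => ?_) ?_ fun i => ?_) <;>
    simp [SymTensor.mk] <;> (try split_ifs) <;> ring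
  map_smul' r f := by
    refine Prod.ext (Fields.ext (fun i j => ?_) ?_ fun i => ?_)
      (Fields.ext (fun i j => ?_) ?_ fun i => ?_) <;>
    simp [SymTensor.mk] <;> (try split_ifs) <;> ring

namespace IsAdaptedFrame

variable {b : Background} {s : Fin 3 → ℝ} {L N : Matrix (Fin 3) (Fin 3) ℝ} {k : ℝ}

theorem transpose_mul (h : IsAdaptedFrame b s L N k) : Nᵀ * Lᵀ = 1 := by
  rw [← Matrix.transpose_mul, h.L_mul_N, Matrix.transpose_one]

/-- The factor `N` is kept on the left so that `contract_mul` can evaluate the contraction with `s`.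
-/
theorem raise_congr (h : IsAdaptedFrame b s L N k) (q : SymTensor) (i j : Fin 3) :
    b.raise (SymTensor.congr Lᵀ q) i j = (N * (q.1 * Nᵀ)) i j := by
  have : b.raise (SymTensor.congr Lᵀ q) i j =
      (b.inv * (SymTensor.congr Lᵀ q).1 * b.invᵀ) i j := by
    simp only [raise, Matrix.mul_apply, Matrix.transpose_apply, Finset.sum_mul]
    rw [Finset.sum_comm]
    exact Finset.sum_congr rfl fun m _ => Finset.sum_congr rfl fun n _ => by ring
  rw [this, SymTensor.coe_congr, h.inv_eq]
  have e : N * Nᵀ * (Lᵀ * q.1 * Lᵀᵀ) * (N * Nᵀ)ᵀ =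
      N * (Nᵀ * Lᵀ) * q.1 * (L * N) * Nᵀ := by
    simp [Matrix.mul_assoc]
  rw [e, h.transpose_mul, h.L_mul_N]
  simp [Matrix.mul_assoc]

theorem trDown_congr (h : IsAdaptedFrame b s L N k) (q : SymTensor) :
    b.trDown (SymTensor.congr Lᵀ q) = q.1.trace := by
  have : b.trDown (SymTensor.congr Lᵀ q) = (b.inv * (SymTensor.congr Lᵀ q).1ᵀ).trace := by
    simp [trDown, Matrix.trace, Matrix.mul_apply]
  rw [this, SymTensor.coe_congr, h.inv_eq, Matrix.mul_assoc, Matrix.trace_mul_comm]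
  have hq : q.1ᵀ = q.1 := q.2
  have e : Nᵀ * (Lᵀ * q.1 * Lᵀᵀ)ᵀ * N = (Nᵀ * Lᵀ) * q.1 * (L * N) := by
    simp [Matrix.mul_assoc, hq]
  rw [e, h.transpose_mul, h.L_mul_N, Matrix.one_mul, Matrix.mul_one]

theorem lower_congr (h : IsAdaptedFrame b s L N k) (p : SymTensor) (i j : Fin 3) :
    b.lower (SymTensor.congr N p) i j = (Lᵀ * (p.1 * L)) i j := by
  have : b.lower (SymTensor.congr N p) i j =
      (b.γ * (SymTensor.congr N p).1 * b.γᵀ) i j := by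
    simp only [lower, Matrix.mul_apply, Matrix.transpose_apply, Finset.sum_mul]
    rw [Finset.sum_comm]
    exact Finset.sum_congr rfl fun m _ => Finset.sum_congr rfl fun n _ => by ring
  rw [this, SymTensor.coe_congr, h.γ_eq]
  have e : Lᵀ * L * (N * p.1 * Nᵀ) * (Lᵀ * L)ᵀ =
      Lᵀ * (L * N) * p.1 * (Nᵀ * Lᵀ) * L := by
    simp [Matrix.mul_assoc]
  rw [e, h.transpose_mul, h.L_mul_N]
  simp [Matrix.mul_assoc]

theorem trUp_congr (h : IsAdaptedFrame b s L N k) (p : SymTensor) :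
    b.trUp (SymTensor.congr N p) = p.1.trace := by
  have : b.trUp (SymTensor.congr N p) = (b.γ * (SymTensor.congr N p).1ᵀ).trace := by
    simp [trUp, Matrix.trace, Matrix.mul_apply]
  rw [this, SymTensor.coe_congr, h.γ_eq, Matrix.mul_assoc, Matrix.trace_mul_comm]
  have hp : p.1ᵀ = p.1 := p.2
  have e : L * (N * p.1 * Nᵀ)ᵀ * Lᵀ = (L * N) * p.1 * (Nᵀ * Lᵀ) := by
    simp [Matrix.mul_assoc, hp]
  rw [e, h.transpose_mul, h.L_mul_N, Matrix.one_mul, Matrix.mul_one]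

theorem lowerVec_mulVec (h : IsAdaptedFrame b s L N k) (v : Fin 3 → ℝ) (i : Fin 3) :
    b.lowerVec (N *ᵥ v) i = (Lᵀ *ᵥ v) i := by
  change (b.γ *ᵥ (N *ᵥ v)) i = _
  rw [h.γ_eq, Matrix.mulVec_mulVec, Matrix.mul_assoc, h.L_mul_N, Matrix.mul_one]

theorem raiseVec_mulVec (h : IsAdaptedFrame b s L N k) (v : Fin 3 → ℝ) (i : Fin 3) :
    b.raiseVec (Lᵀ *ᵥ v) i = (N *ᵥ v) i := by
  change (b.inv *ᵥ (Lᵀ *ᵥ v)) i = _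
  rw [h.inv_eq, Matrix.mulVec_mulVec, Matrix.mul_assoc, h.transpose_mul, Matrix.mul_one]

theorem lowerOne_congr (h : IsAdaptedFrame b s L N k) (p : SymTensor) (i j : Fin 3) :
    b.lowerOne (SymTensor.congr N p) i j = (N * (p.1 * L)) i j := by
  have : b.lowerOne (SymTensor.congr N p) i j = ((SymTensor.congr N p).1 * b.γ) i j := by
    simp only [lowerOne, Matrix.mul_apply]
    exact Finset.sum_congr rfl fun m _ => by rw [b.γ_symm, mul_comm]
  rw [this, SymTensor.coe_congr, h.γ_eq]
  have e : N * p.1 * Nᵀ * (Lᵀ * L) = N * p.1 * (Nᵀ * Lᵀ) * L := by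
    simp [Matrix.mul_assoc]
  rw [e, h.transpose_mul]
  simp [Matrix.mul_assoc]

theorem sum_mul_N (h : IsAdaptedFrame b s L N k) (i : Fin 3) :
    s 0 * N 0 i + s 1 * N 1 i + s 2 * N 2 i = if i = 0 then k else 0 := by
  have := congrFun h.vecMul_eq i
  simp only [Matrix.vecMul, dotProduct, Fin.sum_univ_three, Pi.single_apply] at this
  exact this

theorem s_eq (h : IsAdaptedFrame b s L N k) (i : Fin 3) : s i = k * L 0 i := by
  have := congrArg (fun v => (v ᵥ* L) i) h.vecMul_eq
  simpa [Matrix.vecMul_vecMul, h.N_mul_L] using this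

end IsAdaptedFrame

section Contractions

variable (C : Parameters) (b : Background) (s : Fin 3 → ℝ) (q : Fields)

theorem sum_F_fst (i j : Fin 3) : ((∑ m, s m • F C b m) q).1.1 i j =
    (∑ m, s m * b.β m) * q.1.1 i j + (s i * b.lowerVec q.2.2 j + s j * b.lowerVec q.2.2 i) := by
  simp only [F, SymTensor.mk, Fin.sum_univ_three]
  fin_cases i <;> fin_cases j <;> simp <;> ring

theorem sum_F_snd_fst : ((∑ m, s m • F C b m) q).2.1 =
    (∑ m, s m * b.β m) * q.2.1 + C.C₇ * b.α * ∑ m, s m * q.2.2 m := by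
  simp [F, Fin.sum_univ_three]
  ring

theorem sum_F_snd_snd (i : Fin 3) : ((∑ m, s m • F C b m) q).2.2 i =
    b.α ^ 2 * ((1 + C.C₂) * ∑ m, s m * b.raise q.1 m i -
        1 / 2 * (C.C₂ - C.C₃ + 1) * (∑ m, s m * b.inv m i) * b.trDown q.1) -
      (1 + C.C₅) * b.α * (∑ m, s m * b.inv m i) * q.2.1 + (∑ m, s m * b.β m) * q.2.2 i := by
  simp [F, Fin.sum_univ_three]
  ring

theorem sum_Fdag_fst (i j : Fin 3) : ((∑ m, s m • Fdag C b m) q).1.1 i j =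
    (∑ m, s m * b.β m) * q.1.1 i j + b.α ^ 2 *
      ((1 + C.C₂) * (((∑ m, s m * b.inv m i) * b.raiseVec q.2.2 j +
          (∑ m, s m * b.inv m j) * b.raiseVec q.2.2 i) / 2) -
        1 / 2 * (C.C₂ - C.C₃ + 1) * (∑ m, s m * b.raiseVec q.2.2 m) * b.inv i j) := by
  simp [Fdag, SymTensor.mk, Fin.sum_univ_three]
  ring

theorem sum_Fdag_snd_fst : ((∑ m, s m • Fdag C b m) q).2.1 =
    (∑ m, s m * b.β m) * q.2.1 - (1 + C.C₅) * b.α * ∑ m, s m * b.raiseVec q.2.2 m := by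
  simp [Fdag, Fin.sum_univ_three]
  ring

theorem sum_Fdag_snd_snd (i : Fin 3) : ((∑ m, s m • Fdag C b m) q).2.2 i =
    2 * (∑ m, s m * b.lowerOne q.1 m i) + s i * (C.C₇ * b.α * q.2.1) +
      (∑ m, s m * b.β m) * q.2.2 i := by
  fin_cases i <;> simp [Fdag, Fin.sum_univ_three] <;> ring

theorem sum_V_fst (i j : Fin 3) : ((∑ m, ∑ n, (s m * s n) • V b m n) q).1.1 i j =
    b.vol * (-b.α / 2 * ((∑ n, s n * ∑ m, s m * b.inv m n) * b.inv i j * b.trDown q.1 +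
        ((∑ m, s m * b.inv m i) * (∑ m, s m * b.raise q.1 m j) +
          (∑ m, s m * b.inv m j) * (∑ m, s m * b.raise q.1 m i)) -
        (∑ n, s n * ∑ m, s m * b.inv m n) * b.raise q.1 i j -
        b.inv i j * (∑ n, s n * ∑ m, s m * b.raise q.1 m n) -
        (∑ m, s m * b.inv m i) * (∑ m, s m * b.inv m j) * b.trDown q.1) +
      ((∑ m, s m * b.inv m i) * (∑ m, s m * b.inv m j) -
        (∑ n, s n * ∑ m, s m * b.inv m n) * b.inv i j) * q.2.1) := by
  simp [V, SymTensor.mk, Fin.sum_univ_three, invSym]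
  rw [b.inv_symm i 0, b.inv_symm i 1, b.inv_symm i 2, b.inv_symm j 0, b.inv_symm j 1,
    b.inv_symm j 2, b.raise_symm _ i 0, b.raise_symm _ i 1, b.raise_symm _ i 2,
    b.raise_symm _ j 0, b.raise_symm _ j 1, b.raise_symm _ j 2]
  ring

theorem sum_V_snd_fst : ((∑ m, ∑ n, (s m * s n) • V b m n) q).2.1 =
    b.vol * ((∑ n, s n * ∑ m, s m * b.raise q.1 m n) -
      (∑ n, s n * ∑ m, s m * b.inv m n) * b.trDown q.1) := by
  simp [V, Fin.sum_univ_three]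
  ring

theorem sum_V_snd_snd : ((∑ m, ∑ n, (s m * s n) • V b m n) q).2.2 = 0 := by
  simp [V, Fin.sum_univ_three]

end Contractions

namespace IsAdaptedFrame

variable {b : Background} {s : Fin 3 → ℝ} {L N : Matrix (Fin 3) (Fin 3) ℝ} {k : ℝ}

theorem contract_mul (h : IsAdaptedFrame b s L N k) (A : Matrix (Fin 3) (Fin 3) ℝ) (i : Fin 3) :
    ∑ m, s m * (N * A) m i = k * A 0 i := by
  have := congrArg (fun v => (v ᵥ* A) i) h.vecMul_eq
  rw [Matrix.vecMul_vecMul] at this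
  change (s ᵥ* (N * A)) i = _
  rw [this]
  simp

theorem contract_mulVec (h : IsAdaptedFrame b s L N k) (v : Fin 3 → ℝ) :
    ∑ m, s m * (N *ᵥ v) m = k * v 0 := by
  change s ⬝ᵥ (N *ᵥ v) = _
  rw [Matrix.dotProduct_mulVec, h.vecMul_eq, single_dotProduct]

theorem contract_inv (h : IsAdaptedFrame b s L N k) (i : Fin 3) :
    ∑ m, s m * b.inv m i = k * N i 0 := by
  rw [h.inv_eq, h.contract_mul, Matrix.transpose_apply]

theorem contract_inv_inv (h : IsAdaptedFrame b s L N k) :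
    ∑ n, s n * ∑ m, s m * b.inv m n = k * k := by
  simp only [h.contract_inv, Fin.sum_univ_three]
  have := h.sum_mul_N 0
  rw [if_pos rfl] at this
  linear_combination k * this

theorem contract_raise (h : IsAdaptedFrame b s L N k) (q : SymTensor) (i : Fin 3) :
    ∑ m, s m * b.raise (SymTensor.congr Lᵀ q) m i = k * (q.1 * Nᵀ) 0 i := by
  simp only [h.raise_congr, h.contract_mul]

theorem contract_raise_raise (h : IsAdaptedFrame b s L N k) (q : SymTensor) :
    ∑ n, s n * ∑ m, s m * b.raise (SymTensor.congr Lᵀ q) m n = k * k * q.1 0 0 := by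
  have e : ∀ n, (q.1 * Nᵀ) 0 n = (N *ᵥ q.1 0) n := fun n => by
    simp [Matrix.mul_apply, Matrix.mulVec, dotProduct, mul_comm]
  have := h.contract_mulVec (q.1 0)
  simp only [h.contract_raise, e, mul_left_comm _ k, ← Finset.mul_sum, this]
  ring

theorem inv_apply (h : IsAdaptedFrame b s L N k) (i j : Fin 3) :
    b.inv i j = N i 0 * N j 0 + N i 1 * N j 1 + N i 2 * N j 2 := by
  rw [h.inv_eq]
  simp [Matrix.mul_apply, Fin.sum_univ_three]

theorem γ_apply (h : IsAdaptedFrame b s L N k) (i j : Fin 3) :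
    b.γ i j = L 0 i * L 0 j + L 1 i * L 1 j + L 2 i * L 2 j := by
  rw [h.γ_eq]
  simp [Matrix.mul_apply, Fin.sum_univ_three]

/-- The weights `α` for lapse and shift, `k vol` for the metric momentum and `k vol / α` for the
other momenta are chosen so that every block scales by the common factor `α k`. The shift enters
only through the scalar `s · β`. -/
theorem symbol_frameMap (h : IsAdaptedFrame b s L N k) (C : Parameters) (f : Fields × Fields) :
    (canonicalSystem C b).symbol s (frameMap L N b.α (k * b.vol) (k * b.vol / b.α) f) =
      (∑ i, s i * b.β i) • frameMap L N b.α (k * b.vol) (k * b.vol / b.α) f +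
        (b.α * k) • frameMap L N b.α (k * b.vol) (k * b.vol / b.α) (frameSymbol C f) := by
  have hα : b.α ≠ 0 := b.α_pos.ne'
  have hv : b.vol ≠ 0 := (Real.sqrt_pos.2 b.γ_posDef.det_pos).ne'
  have hk : k ≠ 0 := h.k_ne_zero
  have raiseVec_smul' : ∀ (c : ℝ) v i, b.raiseVec (c • v) i = c * b.raiseVec v i :=
    fun c v i => b.raiseVec_smul c v i
  have lowerOne_smul' : ∀ (c : ℝ) p i j, b.lowerOne (c • p) i j = c * b.lowerOne p i j :=
    fun c p i j => b.lowerOne_smul c p i j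
  obtain ⟨⟨q, a, v⟩, p, σ, r⟩ := f
  rw [canonicalSystem_symbol_apply]
  set S := ∑ i, s i * b.β i with hS
  clear_value S
  refine Prod.ext (Fields.ext (fun i j => ?_) ?_ fun i => ?_)
    (Fields.ext (fun i j => ?_) ?_ fun i => ?_)
  · simp only [Prod.fst_add, Prod.smul_fst, Submodule.coe_add, Submodule.coe_smul,
      Matrix.add_apply, Matrix.smul_apply, smul_eq_mul, sum_F_fst, ← hS]
    simp only [frameMap, frameSymbol, Minv, SymTensor.mk, LinearMap.coe_mk, AddHom.coe_mk,
      Matrix.of_apply, lowerVec_smul, lower_smul, trUp_smul, h.lower_congr, h.trUp_congr,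
      h.lowerVec_mulVec, h.γ_apply, h.s_eq, SymTensor.coe_congr]
    simp only [Matrix.mul_apply, Matrix.mulVec, dotProduct, Fin.sum_univ_three, Matrix.trace,
      Matrix.transpose_apply, Matrix.diag_apply, Matrix.of_apply]
    simp
    field_simp
    ring
  · simp only [Prod.fst_add, Prod.smul_fst, Prod.snd_add, Prod.smul_snd, smul_eq_mul,
      sum_F_snd_fst, ← hS]
    simp only [frameMap, frameSymbol, Minv, LinearMap.coe_mk, AddHom.coe_mk, trUp_smul,
      h.trUp_congr, Pi.smul_apply, smul_eq_mul, mul_left_comm _ b.α, ← Finset.mul_sum,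
      h.contract_mulVec]
    field_simp
    ring
  · simp only [Prod.fst_add, Prod.smul_fst, Prod.snd_add, Prod.smul_snd, Pi.add_apply,
      Pi.smul_apply, smul_eq_mul, sum_F_snd_snd, ← hS]
    simp only [frameMap, frameSymbol, Minv, SymTensor.mk, LinearMap.coe_mk, AddHom.coe_mk,
      Pi.smul_apply, smul_eq_mul, h.contract_raise, h.contract_inv, h.trDown_congr,
      raiseVec_smul', h.raiseVec_mulVec]
    simp only [Matrix.mul_apply, Matrix.mulVec, dotProduct, Fin.sum_univ_three,
      Matrix.transpose_apply]
    simp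
    field_simp
    ring
  · simp only [Prod.fst_add, Prod.snd_add, Prod.smul_snd, Prod.smul_fst, Submodule.coe_add,
      Submodule.coe_smul, Matrix.add_apply, Matrix.smul_apply, smul_eq_mul, sum_Fdag_fst,
      sum_V_fst, ← hS]
    simp only [frameMap, frameSymbol, LinearMap.coe_mk, AddHom.coe_mk, h.contract_raise_raise,
      h.contract_inv_inv, h.trDown_congr]
    simp only [h.contract_raise, h.contract_inv]
    simp only [raiseVec_smul', h.raiseVec_mulVec, h.raise_congr,
      mul_left_comm _ (k * b.vol / b.α), ← Finset.mul_sum, h.contract_mulVec, h.inv_apply,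
      SymTensor.coe_congr, Submodule.coe_smul, Matrix.smul_apply, smul_eq_mul]
    simp only [Matrix.mul_apply, Matrix.mulVec, dotProduct, Fin.sum_univ_three, Matrix.trace,
      Matrix.transpose_apply, Matrix.diag_apply, Matrix.of_apply, SymTensor.mk]
    simp
    field_simp
    ring
  · simp only [Prod.fst_add, Prod.snd_add, Prod.smul_snd, Prod.smul_fst, smul_eq_mul,
      sum_Fdag_snd_fst, sum_V_snd_fst, ← hS]
    simp only [frameMap, frameSymbol, LinearMap.coe_mk, AddHom.coe_mk,
      h.contract_raise_raise, h.contract_inv_inv, h.trDown_congr,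
      raiseVec_smul', h.raiseVec_mulVec, mul_left_comm _ (k * b.vol / b.α), ← Finset.mul_sum,
      h.contract_mulVec]
    field_simp
    ring
  · simp only [Prod.snd_add, Prod.smul_snd, Pi.add_apply, Pi.smul_apply, smul_eq_mul,
      sum_Fdag_snd_snd, sum_V_snd_snd, ← hS]
    simp only [frameMap, frameSymbol, LinearMap.coe_mk, AddHom.coe_mk, Pi.smul_apply,
      smul_eq_mul, lowerOne_smul', h.lowerOne_congr, mul_left_comm _ (k * b.vol),
      ← Finset.mul_sum, h.contract_mul]
    rw [h.s_eq]
    simp only [Matrix.mul_apply, Matrix.mulVec, dotProduct, Fin.sum_univ_three,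
      Matrix.transpose_apply]
    simp
    field_simp
    ring

end IsAdaptedFrame

theorem locallyModelled_canonicalSystem (C : Parameters) (b : Background) :
    LocallyModelled (canonicalSystem C b).symbol b.β (frameSymbol C) := by
  have hα : b.α ≠ 0 := b.α_pos.ne'
  have hv : b.vol ≠ 0 := (Real.sqrt_pos.2 b.γ_posDef.det_pos).ne'
  intro s₀ hs₀
  obtain ⟨U, hU, L, N, k, hL, hN, hk, H⟩ := exists_isAdaptedFrame b hs₀
  have hk0 : ∀ s ∈ U, k s ≠ 0 := fun s hs => (H s hs).k_ne_zero
  refine ⟨U, hU, fun s => frameMap (L s) (N s) b.α (k s * b.vol) (k s * b.vol / b.α),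
    fun s => frameMap (N s) (L s) b.α⁻¹ (k s * b.vol)⁻¹ (k s * b.vol / b.α)⁻¹,
    fun s => b.α * k s, fun f => ?_, fun f => ?_, continuousOn_const.mul hk, fun s hs => ?_⟩
  · exact continuousOn_frameMap hL hN continuousOn_const (hk.mul continuousOn_const)
      ((hk.mul continuousOn_const).div_const _) f
  · refine continuousOn_frameMap hN hL continuousOn_const
      ((hk.mul continuousOn_const).inv₀ fun s hs => mul_ne_zero (hk0 s hs) hv)
      (((hk.mul continuousOn_const).div_const _).inv₀ fun s hs =>
        div_ne_zero (mul_ne_zero (hk0 s hs) hv) hα) f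
  · have h1 : k s * b.vol ≠ 0 := mul_ne_zero (hk0 s hs) hv
    have h2 : k s * b.vol / b.α ≠ 0 := div_ne_zero h1 hα
    refine ⟨mul_ne_zero hα (hk0 s hs), fun f => ?_, fun f => ?_, fun f => ?_⟩
    · exact frameMap_frameMap (H s hs).L_mul_N hα h1 h2 f
    · have := frameMap_frameMap (H s hs).N_mul_L (inv_ne_zero hα) (inv_ne_zero h1)
        (inv_ne_zero h2) f
      simpa only [inv_inv] using this
    · exact (H s hs).symbol_frameMap C f

end HamiltonianGR

/-! ### Off-diagonal block matrices -/

/-- The endomorphism `(e, o) ↦ (A o, B e)`. -/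
def offDiag {n : ℕ} (A B : Matrix (Fin n) (Fin n) ℝ) :
    Module.End ℝ ((Fin n → ℝ) × (Fin n → ℝ)) where
  toFun x := (A *ᵥ x.2, B *ᵥ x.1)
  map_add' x y := by simp [Matrix.mulVec_add]
  map_smul' r x := by simp [Matrix.mulVec_smul]

section OffDiag

variable {n : ℕ} {A B : Matrix (Fin n) (Fin n) ℝ}

theorem offDiag_apply (x : (Fin n → ℝ) × (Fin n → ℝ)) :
    offDiag A B x = (A *ᵥ x.2, B *ᵥ x.1) := rfl

theorem isUnit_and_isUnit_of_mul (h : IsUnit (A * B)) : IsUnit A ∧ IsUnit B := by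
  rw [Matrix.isUnit_iff_isUnit_det, Matrix.det_mul, IsUnit.mul_iff] at h
  simpa only [Matrix.isUnit_iff_isUnit_det] using h

theorem offDiag_injective (h : IsUnit (A * B)) : Function.Injective (offDiag A B) := by
  obtain ⟨hA, hB⟩ := isUnit_and_isUnit_of_mul h
  rintro ⟨e, o⟩ ⟨e', o'⟩ hxy
  simp only [offDiag_apply, Prod.mk.injEq] at hxy
  exact Prod.ext (Matrix.mulVec_injective_of_isUnit hB hxy.2)
    (Matrix.mulVec_injective_of_isUnit hA hxy.1)

theorem EigSep.offDiag_of_mul_eq_smul {c : ℝ} (hc : 0 < c) (h : A * B = c • 1) :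
    EigSep (offDiag A B) := by
  have h' : B * A = c • 1 := by
    have : (c⁻¹ • A) * B = 1 := by
      rw [smul_mul_assoc, h, smul_smul, inv_mul_cancel₀ hc.ne', one_smul]
    have := mul_eq_one_comm.1 this
    rw [mul_smul_comm] at this
    rw [← this, smul_smul, mul_inv_cancel₀ hc.ne', one_smul]
  refine EigSep.of_sq hc fun x => ?_
  simp only [offDiag_apply, Matrix.mulVec_mulVec, h, h', Matrix.smul_mulVec, Matrix.one_mulVec]
  rfl

theorem isUnit_of_quadratic {M : Matrix (Fin n) (Fin n) ℝ} {t d : ℝ} (hd : d ≠ 0)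
    (h : M * M = t • M - d • 1) : IsUnit M := by
  refine IsUnit.of_mul_eq_one (d⁻¹ • (t • 1 - M)) ?_
  rw [mul_smul_comm, mul_sub, h, mul_smul_comm, mul_one, sub_sub_cancel, smul_smul,
    inv_mul_cancel₀ hd, one_smul]

/-- The square of `offDiag A B` has the blocks `A * B` and `B * A`. As `a * b ≠ 0` makes `A`
invertible, the quadratic equation passes from the former to the latter, and `of_sq_mul_sq` applies.
-/
theorem EigSep.offDiag_of_quadratic {a b : ℝ} (ha : 0 < a) (hb : 0 < b) (hab : a ≠ b)
    (h : (A * B) * (A * B) = (a + b) • (A * B) - (a * b) • 1) : EigSep (offDiag A B) := by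
  have hA : IsUnit A := (isUnit_and_isUnit_of_mul (isUnit_of_quadratic (mul_pos ha hb).ne' h)).1
  have h' : (B * A) * (B * A) = (a + b) • (B * A) - (a * b) • 1 := by
    refine hA.mul_left_cancel ?_
    have := congrArg (· * A) h
    simp only [sub_mul, smul_mul_assoc, one_mul] at this
    rw [mul_sub, mul_smul_comm, mul_smul_comm, mul_one]
    simpa only [mul_assoc] using this
  refine EigSep.of_sq_mul_sq ha hb hab fun x => ?_
  have e1 : A * (B * (A * B)) = (a + b) • (A * B) - (a * b) • 1 := by rw [← h]; simp [mul_assoc]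
  have e2 : B * (A * (B * A)) = (a + b) • (B * A) - (a * b) • 1 := by rw [← h']; simp [mul_assoc]
  simp only [offDiag_apply, Matrix.mulVec_mulVec, e1, e2, Matrix.sub_mulVec, Matrix.smul_mulVec,
    Matrix.one_mulVec]
  rfl

/-- Functionals on the product are pairs of row vectors, and the eigenvalue equation splits into its
two blocks. -/
theorem EigSep.offDiag_dual (h : EigSep (offDiag A B)) {x : (Fin n → ℝ) × (Fin n → ℝ)}
    (hx : ∀ (f g : Fin n → ℝ) (μ : ℝ), f ᵥ* A = μ • g → g ᵥ* B = μ • f →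
      f ⬝ᵥ x.1 + g ⬝ᵥ x.2 = 0) : x = 0 := by
  refine h x fun φ μ hφ => ?_
  let f : Fin n → ℝ := fun i => φ (Pi.single i 1, 0)
  let g : Fin n → ℝ := fun i => φ (0, Pi.single i 1)
  have hφ' : ∀ y, φ y = f ⬝ᵥ y.1 + g ⬝ᵥ y.2 := by
    rintro ⟨e, o⟩
    have h1 : (e, o) = LinearMap.inl ℝ (Fin n → ℝ) (Fin n → ℝ) e +
        LinearMap.inr ℝ (Fin n → ℝ) (Fin n → ℝ) o := by simp
    have h2 : φ (LinearMap.inl ℝ (Fin n → ℝ) (Fin n → ℝ) e) = f ⬝ᵥ e := by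
      rw [← LinearMap.comp_apply, LinearMap.pi_apply_eq_sum_univ]
      simp only [dotProduct, f, LinearMap.comp_apply, LinearMap.inl_apply, smul_eq_mul]
      refine Finset.sum_congr rfl fun i _ => ?_
      rw [mul_comm]
      congr with j
      simp [Pi.single_apply, eq_comm]
    have h3 : φ (LinearMap.inr ℝ (Fin n → ℝ) (Fin n → ℝ) o) = g ⬝ᵥ o := by
      rw [← LinearMap.comp_apply, LinearMap.pi_apply_eq_sum_univ]
      simp only [dotProduct, g, LinearMap.comp_apply, LinearMap.inr_apply, smul_eq_mul]
      refine Finset.sum_congr rfl fun i _ => ?_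
      rw [mul_comm]
      congr with j
      simp [Pi.single_apply, eq_comm]
    have h4 := congrArg φ h1
    rwa [map_add, h2, h3] at h4
  rw [hφ']
  refine hx f g μ ?_ ?_
  · funext i
    have := hφ (0, Pi.single i 1)
    rw [hφ', hφ', offDiag_apply] at this
    simp only [Matrix.dotProduct_mulVec, Matrix.mulVec_zero, dotProduct_zero, add_zero, zero_add,
      dotProduct_single_one] at this
    exact this
  · funext i
    have := hφ (Pi.single i 1, 0)
    rw [hφ', hφ', offDiag_apply] at this
    simp only [Matrix.dotProduct_mulVec, Matrix.mulVec_zero, dotProduct_zero, add_zero, zero_add,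
      dotProduct_single_one] at this
    exact this

/-- The source of all necessary conditions: an identity checked on left eigenvectors becomes a
matrix identity, whose entries can be read off. -/
theorem EigSep.matrix_eq_zero_fst (h : EigSep (offDiag A B)) {M : Matrix (Fin n) (Fin n) ℝ}
    (hM : ∀ (f g : Fin n → ℝ) (μ : ℝ), f ᵥ* A = μ • g → g ᵥ* B = μ • f → f ᵥ* M = 0) :
    M = 0 := by
  refine Matrix.ext_of_mulVec_single fun i => ?_
  have := h.offDiag_dual (x := (M *ᵥ Pi.single i 1, 0)) fun f g μ h1 h2 => by
    simp only [Matrix.dotProduct_mulVec, hM f g μ h1 h2, zero_dotProduct, dotProduct_zero, add_zero]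
  rw [Matrix.zero_mulVec]
  exact congrArg Prod.fst this

theorem EigSep.matrix_eq_zero_snd (h : EigSep (offDiag A B)) {M : Matrix (Fin n) (Fin n) ℝ}
    (hM : ∀ (f g : Fin n → ℝ) (μ : ℝ), f ᵥ* A = μ • g → g ᵥ* B = μ • f → g ᵥ* M = 0) :
    M = 0 := by
  refine Matrix.ext_of_mulVec_single fun i => ?_
  have := h.offDiag_dual (x := (0, M *ᵥ Pi.single i 1)) fun f g μ h1 h2 => by
    simp only [Matrix.dotProduct_mulVec, hM f g μ h1 h2, zero_dotProduct, dotProduct_zero, add_zero]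
  rw [Matrix.zero_mulVec]
  exact congrArg Prod.snd this

theorem EigSep.exists_ne_zero [NeZero n] (h : EigSep (offDiag A B)) :
    ∃ (f g : Fin n → ℝ) (μ : ℝ), f ᵥ* A = μ • g ∧ g ᵥ* B = μ • f ∧ f ≠ 0 := by
  by_contra! hne
  have : (1 : Matrix (Fin n) (Fin n) ℝ) = 0 := h.matrix_eq_zero_fst fun f g μ h1 h2 => by
    rw [hne f g μ h1 h2, Matrix.zero_vecMul]
  exact one_ne_zero this

theorem vecMul_mul_eq_smul {f g : Fin n → ℝ} {μ : ℝ} (h1 : f ᵥ* A = μ • g)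
    (h2 : g ᵥ* B = μ • f) : f ᵥ* (A * B) = (μ * μ) • f := by
  rw [← Matrix.vecMul_vecMul, h1, Matrix.smul_vecMul, h2, smul_smul]

end OffDiag

namespace HamiltonianGR

open Background

/-! ### The vector sector -/

/-- The equations for `(h_{1A}, r_A)` in terms of `(v_A, p_{1A})`. -/
def vectorA : Matrix (Fin 2) (Fin 2) ℝ := !![1, 2; 0, 2]

/-- The equations for `(v_A, p_{1A})` in terms of `(h_{1A}, r_A)`. -/
def vectorB (l c : ℝ) : Matrix (Fin 2) (Fin 2) ℝ := !![l, -c; 0, l / 2]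

theorem vectorA_mul_vectorB (l c : ℝ) : vectorA * vectorB l c = !![l, l - c; 0, l] := by
  ext i j
  fin_cases i <;> fin_cases j <;> simp [vectorA, vectorB, Matrix.mul_apply] <;> ring

theorem vectorA_mul_vectorB_self (l : ℝ) : vectorA * vectorB l l = l • 1 := by
  rw [vectorA_mul_vectorB]
  ext i j
  fin_cases i <;> fin_cases j <;> simp

/-- The product `A * B` is triangular with `l` twice on the diagonal, so it must equal `l • 1`,
which forces `c = l`. Then `l = μ² ≥ 0`, and `μ = 0` would give a nonzero row vector killed by the
invertible `vectorA`. -/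
theorem eigSep_vector {l c : ℝ} (h : EigSep (offDiag vectorA (vectorB l c))) : 0 < l ∧ c = l := by
  have h1 : vectorA * vectorB l c - l • 1 = 0 := h.matrix_eq_zero_fst fun f g μ h1 h2 => by
    have h3 := vecMul_mul_eq_smul h1 h2
    rw [Matrix.vecMul_sub, h3, Matrix.vecMul_smul, Matrix.vecMul_one, ← sub_smul]
    rw [vectorA_mul_vectorB] at h3
    have e0 := congrFun h3 0
    have e1 := congrFun h3 1
    simp [Matrix.vecMul, dotProduct, Fin.sum_univ_two] at e0 e1
    by_contra hne
    have hν : μ * μ - l ≠ 0 := fun h0 => hne (by rw [h0, zero_smul])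
    have f0 : f 0 = 0 := by
      refine (mul_eq_zero.1 ?_).resolve_left hν
      linear_combination -e0
    rw [f0] at e1
    have f1 : f 1 = 0 := by
      refine (mul_eq_zero.1 ?_).resolve_left hν
      linear_combination -e1
    refine hne ?_
    have : f = 0 := by
      funext i
      fin_cases i
      · exact f0
      · exact f1
    rw [this, smul_zero]
  have hc : l - c = 0 := by
    have := congrFun (congrFun h1 0) 1
    rw [vectorA_mul_vectorB] at this
    simpa using this
  obtain ⟨f, g, μ, h2, h3, hf⟩ := h.exists_ne_zero
  have h4 := vecMul_mul_eq_smul h2 h3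
  rw [sub_eq_zero.1 h1, Matrix.vecMul_smul, Matrix.vecMul_one] at h4
  have hl : l = μ * μ := smul_left_injective ℝ hf h4
  refine ⟨lt_of_le_of_ne (hl ▸ mul_self_nonneg μ) fun h0 => hf ?_, (sub_eq_zero.1 hc).symm⟩
  have hμ : μ = 0 := by simpa using (h0.trans hl).symm
  rw [hμ, zero_smul] at h2
  have e0 := congrFun h2 0
  have e1 := congrFun h2 1
  simp [vectorA, Matrix.vecMul, dotProduct, Fin.sum_univ_two] at e0 e1
  rw [e0] at e1
  funext i
  fin_cases i
  · exact e0
  · simpa using e1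

/-! ### The scalar sector -/

/-- The equations for `(h_{11}, a, h_{22} + h_{33} + r_1, r_1)` in terms of
`(v_1, p_{22} + p_{33}, σ, p_{11})`. -/
def scalarA (k m c₇ : ℝ) : Matrix (Fin 4) (Fin 4) ℝ :=
  !![2, -1, -k, 1; c₇, -k, m, -k; 0, 0, c₇ - 2 * k, 0; 0, 0, c₇, 2]

/-- The equations for `(v_1, p_{22} + p_{33}, σ, p_{11})` in terms of
`(h_{11}, a, h_{22} + h_{33} + r_1, r_1)`. -/
def scalarB (l u c₅ : ℝ) : Matrix (Fin 4) (Fin 4) ℝ :=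
  !![u / 2, -(1 + c₅), u / 2 - l, -u / 2; 0, -2, -1 / 2, 1 / 2 - 2 * l + u; 0, 0, -1, -c₅;
    0, 0, 0, u / 2]

section Scalar

variable (l u k m c₅ c₇ : ℝ)

/-- Here `l = λ_V²`, `u = λ_+²`, `2k - c₇ = λ_-²`, with `k = 1/2 + C₁` and `m = 1/4 + 2 C₄`. Both
diagonal 2 × 2 blocks have trace `t = λ_-² + λ_+² - c₅ c₇` and determinant `λ_-² λ_+²`, hence the
same characteristic polynomial `χ`, with roots `v_±²`. The parameters `l` and `m` enter only the
upper right block. -/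
theorem scalarA_mul_scalarB : scalarA k m c₇ * scalarB l u c₅ =
    !![u, -2 * c₅, u + 1 / 2 + k - 2 * l, 2 * l - 1 / 2 - 3 / 2 * u + k * c₅;
      c₇ * u / 2, 2 * k - c₇ - c₅ * c₇, c₇ * u / 2 - c₇ * l + k / 2 - m,
        2 * k * l - 3 / 2 * k * u - c₇ * u / 2 - k / 2 - m * c₅;
      0, 0, 2 * k - c₇, (2 * k - c₇) * c₅;
      0, 0, -c₇, u - c₅ * c₇] := by
  ext i j
  fin_cases i <;> fin_cases j <;>
    simp [scalarA, scalarB, Matrix.mul_apply, Fin.sum_univ_four] <;> ring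

variable {l u k m c₅ c₇}

theorem scalar_left_eigenvector {f g : Fin 4 → ℝ} {μ : ℝ} (h1 : f ᵥ* scalarA k m c₇ = μ • g)
    (h2 : g ᵥ* scalarB l u c₅ = μ • f) :
    ((μ * μ) ^ 2 - (2 * k - c₇ + u - c₅ * c₇) * (μ * μ) + (2 * k - c₇) * u) • f = 0 := by
  have h3 := vecMul_mul_eq_smul h1 h2
  rw [scalarA_mul_scalarB] at h3
  have e0 := congrFun h3 0
  have e1 := congrFun h3 1
  have e2 := congrFun h3 2
  have e3 := congrFun h3 3
  simp [Matrix.vecMul, dotProduct, Fin.sum_univ_four] at e0 e1 e2 e3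
  set ν := μ * μ
  by_contra hne
  have hν : ν ^ 2 - (2 * k - c₇ + u - c₅ * c₇) * ν + (2 * k - c₇) * u ≠ 0 :=
    fun h0 => hne (by rw [h0, zero_smul])
  -- The coefficients come from the adjugate of the first diagonal block minus `ν`; for `f2` and
  -- `f3` below, from that of the second.
  have f0 : f 0 = 0 := by
    refine (mul_eq_zero.1 ?_).resolve_left hν
    linear_combination -(ν - (2 * k - c₇ - c₅ * c₇)) * e0 - c₇ * u / 2 * e1
  have f1 : f 1 = 0 := by
    refine (mul_eq_zero.1 ?_).resolve_left hν
    linear_combination -(ν - u) * e1 + 2 * c₅ * e0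
  rw [f0, f1] at e2 e3
  have f2 : f 2 = 0 := by
    refine (mul_eq_zero.1 ?_).resolve_left hν
    linear_combination -(ν - (u - c₅ * c₇)) * e2 + c₇ * e3
  have f3 : f 3 = 0 := by
    refine (mul_eq_zero.1 ?_).resolve_left hν
    linear_combination -(ν - (2 * k - c₇)) * e3 - (2 * k - c₇) * c₅ * e2
  refine hne ?_
  have : f = 0 := by
    funext i
    fin_cases i
    exacts [f0, f1, f2, f3]
  rw [this, smul_zero]

theorem vecMul_quadratic {n : ℕ} {f : Fin n → ℝ} {M : Matrix (Fin n) (Fin n) ℝ} {ν t d : ℝ}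
    (h : f ᵥ* M = ν • f) : f ᵥ* (M * M - t • M + d • 1) = (ν ^ 2 - t * ν + d) • f := by
  rw [Matrix.vecMul_add, Matrix.vecMul_sub, ← Matrix.vecMul_vecMul, h, Matrix.smul_vecMul, h,
    Matrix.vecMul_smul, h, Matrix.vecMul_smul, Matrix.vecMul_one]
  module

theorem scalar_quadratic (h : EigSep (offDiag (scalarA k m c₇) (scalarB l u c₅))) :
    (scalarA k m c₇ * scalarB l u c₅) * (scalarA k m c₇ * scalarB l u c₅) -
      (2 * k - c₇ + u - c₅ * c₇) • (scalarA k m c₇ * scalarB l u c₅) +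
      ((2 * k - c₇) * u) • 1 = 0 :=
  h.matrix_eq_zero_fst fun _ _ _ h1 h2 => by
    rw [vecMul_quadratic (vecMul_mul_eq_smul h1 h2), scalar_left_eigenvector h1 h2]

/-- Hyperbolicity excludes vanishing characteristic speeds in the scalar sector. -/
theorem scalar_speeds_ne_zero (h : EigSep (offDiag (scalarA k m c₇) (scalarB l u c₅)))
    (hm : m + 3 * k ^ 2 ≠ 0) : (2 * k - c₇) * u ≠ 0 := by
  intro h0
  set t := 2 * k - c₇ + u - c₅ * c₇ with ht
  -- If the determinant vanishes, `χ(μ²) = μ² (μ² - t)`. Hence `μ³ = t μ` on all eigenfunctionals,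
  -- which yields `A B A = t A` and `B A B = t B`. These are stronger than `χ(A B) = 0`.
  have cubic : ∀ {f g : Fin 4 → ℝ} {μ : ℝ}, f ᵥ* scalarA k m c₇ = μ • g →
      g ᵥ* scalarB l u c₅ = μ • f → μ = 0 ∨ f = 0 ∨ μ * μ = t := by
    intro f g μ h1 h2
    have := scalar_left_eigenvector h1 h2
    rw [← ht, h0] at this
    rcases smul_eq_zero.1 this with h3 | h3
    · by_cases hμ : μ = 0
      · exact .inl hμ
      · refine .inr (.inr (mul_left_cancel₀ (mul_ne_zero hμ hμ) ?_))
        linear_combination h3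
    · exact .inr (.inl h3)
  have hA : scalarA k m c₇ * scalarB l u c₅ * scalarA k m c₇ - t • scalarA k m c₇ = 0 :=
    h.matrix_eq_zero_fst fun f g μ h1 h2 => by
      rw [Matrix.vecMul_sub, ← Matrix.vecMul_vecMul, vecMul_mul_eq_smul h1 h2, Matrix.vecMul_smul,
        Matrix.smul_vecMul, h1]
      rcases cubic h1 h2 with h3 | h3 | h3
      · simp [h3]
      · rw [← h1, h3]; simp
      · rw [h3, sub_self]
  have hB : scalarB l u c₅ * (scalarA k m c₇ * scalarB l u c₅) - t • scalarB l u c₅ = 0 :=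
    h.matrix_eq_zero_snd fun f g μ h1 h2 => by
      rw [Matrix.vecMul_sub, ← Matrix.vecMul_vecMul, Matrix.vecMul_smul, h2, Matrix.smul_vecMul,
        vecMul_mul_eq_smul h1 h2]
      rcases cubic h1 h2 with h3 | h3 | h3
      · simp [h3]
      · simp [h3]
      · rw [h3, smul_comm, sub_self]
  have hu : u = 0 := by
    have := congrFun (congrFun hB 2) 2
    rw [scalarA_mul_scalarB] at this
    simp [scalarB] at this
    linear_combination this - ht
  have hk : c₇ = 2 * k := by
    have := congrFun (congrFun hA 3) 3
    rw [scalarA_mul_scalarB] at this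
    simp [scalarA] at this
    linear_combination this / 2 + ht
  have e1 : 2 * l - 1 / 2 = - 3 * c₅ * k := by
    have := congrFun (congrFun hA 0) 3
    rw [scalarA_mul_scalarB] at this
    simp [scalarA, hu, hk] at this
    simp only [hu, hk] at ht
    linear_combination this / 2 + ht / 2
  -- The entries combine to `c₅ (m + 3 k²) = 0`, the only place where nondegeneracy of the kinetic
  -- matrix enters.
  have hc₅ : c₅ = 0 := by
    have := congrFun (congrFun hA 0) 2
    rw [scalarA_mul_scalarB] at this
    simp [scalarA, hu, hk] at this
    simp only [hu, hk] at ht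
    refine (mul_eq_zero.1 ?_).resolve_right hm
    linear_combination -this / 2 + k * ht / 2 + k * e1
  have ht0 : t = 0 := by rw [ht, hu, hk, hc₅]; ring
  -- Now `t = 0`, so `g B = μ f = 0` for every eigenpair, whereas `B` has an entry `-1`.
  have hB0 : scalarB l u c₅ = 0 := h.matrix_eq_zero_snd fun f g μ h1 h2 => by
    rw [h2]
    rcases cubic h1 h2 with h3 | h3 | h3
    · rw [h3, zero_smul]
    · rw [h3, smul_zero]
    · rw [ht0] at h3
      rw [mul_self_eq_zero.1 h3, zero_smul]
  have := congrFun (congrFun hB0 2) 2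
  simp [scalarB] at this

/-- The conditions for hyperbolicity of the scalar sector. -/
structure ScalarConditions (l u k m c₅ c₇ D : ℝ) : Prop where
  disc_nonneg : 0 ≤ D
  plus_pos : 0 < 2 * k - c₇ + u - c₅ * c₇ + √D
  minus_pos : 0 < 2 * k - c₇ + u - c₅ * c₇ - √D
  coupling : (D = 0 ∧ c₅ = 0 ∧ c₇ = 0 ∧ 2 * k = u ∧ 4 * l = 3 * u + 1 ∧ 4 * m = u) ∨
    (D ≠ 0 ∧ c₅ * (4 * m - (2 * k - c₇)) = c₇ * (4 * l - 3 * u - 1) ∧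
      (4 * l - 3 * u - 1) * ((1 + 2 * c₅) * (2 * k - c₇) - u) =
        c₅ * (c₅ * (2 * k - c₇) + 3 * c₇ * u) ∧
      (4 * m - (2 * k - c₇)) * ((1 + 2 * c₅) * (2 * k - c₇) - u) =
        c₇ * (c₅ * (2 * k - c₇) + 3 * c₇ * u))

/-- A real eigenvalue makes `D` a square, and nonnegativity of `μ²` makes the roots of `χ` positive.
The coupling conditions are entries of `χ(A B) = 0`, or of `A B = (t / 2) • 1` if the root is
double. -/
theorem scalar_conditions (h : EigSep (offDiag (scalarA k m c₇) (scalarB l u c₅)))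
    (hm : m + 3 * k ^ 2 ≠ 0) {D : ℝ}
    (hD : D = (2 * k - c₇ + u - c₅ * c₇) ^ 2 - 4 * ((2 * k - c₇) * u)) :
    ScalarConditions l u k m c₅ c₇ D := by
  have hne := scalar_speeds_ne_zero h hm
  set t := 2 * k - c₇ + u - c₅ * c₇ with ht
  obtain ⟨f₀, g₀, μ₀, h1₀, h2₀, hf₀⟩ := h.exists_ne_zero
  have hχ : ∀ {f g : Fin 4 → ℝ} {μ : ℝ}, f ᵥ* scalarA k m c₇ = μ • g →
      g ᵥ* scalarB l u c₅ = μ • f →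
      f = 0 ∨ (μ * μ) ^ 2 - t * (μ * μ) + (2 * k - c₇) * u = 0 := fun h1 h2 =>
    (smul_eq_zero.1 (scalar_left_eigenvector h1 h2)).symm
  have hχ₀ := (hχ h1₀ h2₀).resolve_left hf₀
  have hD0 : 0 ≤ D := by
    have : D = (2 * (μ₀ * μ₀) - t) ^ 2 := by linear_combination hD - 4 * hχ₀
    rw [this]; positivity
  have hs : √D * √D = D := Real.mul_self_sqrt hD0
  have hs0 : 0 ≤ √D := Real.sqrt_nonneg D
  have hprod : (t + √D) * (t - √D) = 4 * ((2 * k - c₇) * u) := by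
    linear_combination -hs - hD
  have hscal : ∀ v : ℝ, (∀ {f g : Fin 4 → ℝ} {μ : ℝ}, f ᵥ* scalarA k m c₇ = μ • g →
      g ᵥ* scalarB l u c₅ = μ • f → f = 0 ∨ μ * μ = v) →
      scalarA k m c₇ * scalarB l u c₅ = v • 1 := fun v hv => by
    rw [← sub_eq_zero]
    refine h.matrix_eq_zero_fst fun f g μ h1 h2 => ?_
    rw [Matrix.vecMul_sub, vecMul_mul_eq_smul h1 h2, Matrix.vecMul_smul, Matrix.vecMul_one]
    rcases hv h1 h2 with h3 | h3
    · simp [h3]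
    · rw [h3, sub_self]
  -- A negative root is never of the form `μ²`, so `A B` would be the larger root times the
  -- identity. Its diagonal then gives `√D = 0`, and the larger root would be negative too.
  have hminus : 0 < t - √D := by
    by_contra hneg
    have hlt : t - √D < 0 := lt_of_le_of_ne (not_lt.1 hneg) fun h0 => by
      rw [h0, mul_zero] at hprod
      exact hne (by linarith)
    have hroot : ∀ {μ : ℝ}, (μ * μ) ^ 2 - t * (μ * μ) + (2 * k - c₇) * u = 0 →
        μ * μ = (t + √D) / 2 := fun {μ} hμ => by
      have h3 : (2 * (μ * μ) - (t - √D)) * (2 * (μ * μ) - (t + √D)) = 0 := by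
        linear_combination 4 * hμ + hprod
      have h4 : 2 * (μ * μ) - (t - √D) ≠ 0 := by nlinarith [mul_self_nonneg μ]
      have := (mul_eq_zero.1 h3).resolve_left h4
      linarith
    have hAB := hscal ((t + √D) / 2) fun h1 h2 => (hχ h1 h2).imp id hroot
    rw [scalarA_mul_scalarB] at hAB
    have a1 := congrFun (congrFun hAB 2) 2
    have a2 := congrFun (congrFun hAB 3) 3
    simp at a1 a2
    have h5 : √D = 0 := by linarith
    have h6 := hroot hχ₀
    nlinarith [mul_self_nonneg μ₀]
  refine ⟨hD0, by linarith, hminus, ?_⟩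
  by_cases hDz : D = 0
  · left
    have hAB := hscal (t / 2) fun {f g μ} h1 h2 => (hχ h1 h2).imp id fun h3 => by
      have : (2 * (μ * μ) - t) ^ 2 = 0 := by linear_combination 4 * h3 - hD + hDz
      have := pow_eq_zero_iff two_ne_zero |>.1 this
      linarith
    rw [scalarA_mul_scalarB] at hAB
    have a1 := congrFun (congrFun hAB 2) 2
    have a2 := congrFun (congrFun hAB 3) 3
    have a3 := congrFun (congrFun hAB 2) 3
    have a4 := congrFun (congrFun hAB 3) 2
    have a5 := congrFun (congrFun hAB 0) 2
    have a6 := congrFun (congrFun hAB 1) 2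
    simp at a1 a2 a3 a4 a5 a6
    have c7 : c₇ = 0 := a4
    have c5 : c₅ = 0 := a3.resolve_left (left_ne_zero_of_mul hne)
    rw [c7] at a1 a2 a6
    have hku : 2 * k = u := by linarith
    refine ⟨hDz, c5, c7, hku, by linarith, by linarith⟩
  · right
    have hq := scalar_quadratic h
    rw [scalarA_mul_scalarB] at hq
    have a1 := congrFun (congrFun hq 0) 2
    have a2 := congrFun (congrFun hq 0) 3
    have a3 := congrFun (congrFun hq 1) 2
    simp at a1 a2 a3
    have b1 : c₅ * (4 * m - (2 * k - c₇)) = c₇ * (4 * l - 3 * u - 1) := by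
      linear_combination 2 * a1
    refine ⟨hDz, b1, ?_, ?_⟩
    · linear_combination -2 * a2 + c₅ * b1
    · linear_combination -4 * a3 + c₇ * b1 + 2 * (2 * k - c₇) * b1

/-- The coupling conditions are exactly `A B = u • 1` for a double root and `χ(A B) = 0` for
distinct roots; positivity of the roots then gives diagonalizability and invertibility. -/
theorem ScalarConditions.eigSep {D : ℝ} (h : ScalarConditions l u k m c₅ c₇ D)
    (hD : D = (2 * k - c₇ + u - c₅ * c₇) ^ 2 - 4 * ((2 * k - c₇) * u)) :
    EigSep (offDiag (scalarA k m c₇) (scalarB l u c₅)) ∧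
      IsUnit (scalarA k m c₇ * scalarB l u c₅) := by
  obtain ⟨hD0, hp, hm, hc⟩ := h
  have hs : √D * √D = D := Real.mul_self_sqrt hD0
  set t := 2 * k - c₇ + u - c₅ * c₇ with ht
  rcases hc with ⟨hDz, c5, c7, hku, hl, hmu⟩ | ⟨hDz, b1, b2, b3⟩
  · have hu : 0 < u := by
      rw [hDz, Real.sqrt_zero, ht, c5, c7] at hp
      linarith
    have hAB : scalarA k m c₇ * scalarB l u c₅ = u • 1 := by
      have hl' : l = (3 * u + 1) / 4 := by linarith
      have hm' : m = u / 4 := by linarith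
      have hk' : k = u / 2 := by linarith
      rw [scalarA_mul_scalarB, c5, c7, hl', hm', hk']
      ext i j
      fin_cases i <;> fin_cases j <;> simp <;> ring
    refine ⟨EigSep.offDiag_of_mul_eq_smul hu hAB, ?_⟩
    rw [hAB]
    exact (Matrix.isUnit_iff_isUnit_det _).2 (by simp [hu.ne'])
  · have hpm : (t + √D) / 2 * ((t - √D) / 2) = (2 * k - c₇) * u := by
      linear_combination (-hs - hD) / 4
    have hq : scalarA k m c₇ * scalarB l u c₅ * (scalarA k m c₇ * scalarB l u c₅) =
        ((t + √D) / 2 + (t - √D) / 2) • (scalarA k m c₇ * scalarB l u c₅) -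
          ((t + √D) / 2 * ((t - √D) / 2)) • 1 := by
      rw [hpm, show (t + √D) / 2 + (t - √D) / 2 = t by ring, scalarA_mul_scalarB]
      ext i j
      fin_cases i <;> fin_cases j <;> simp [Matrix.mul_apply, Fin.sum_univ_four, ht]
      · ring
      · ring
      · linear_combination b1 / 2
      · linear_combination -b2 / 2 + c₅ * b1 / 2
      · ring
      · ring
      · linear_combination -b3 / 4 + c₇ * b1 / 4 + (2 * k - c₇) * b1 / 2
      -- The last entry of the upper right block imposes no further condition.
      · linear_combination -c₇ * b2 / 4 + (c₅ * c₇ - (2 * k - c₇)) * b1 / 4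
      all_goals ring
    have hpos : 0 < (t + √D) / 2 * ((t - √D) / 2) := mul_pos (by linarith) (by linarith)
    refine ⟨EigSep.offDiag_of_quadratic (by linarith) (by linarith) ?_ hq,
      isUnit_of_quadratic hpos.ne' hq⟩
    intro heq
    refine hDz ?_
    have : √D = 0 := by linarith
    rw [← hs, this, mul_zero]

end Scalar

/-! ### Decomposition into scalar, vector and tensor sectors -/

/-- The scalar part of a perturbation in an adapted frame. -/
def scalarPart : Fields × Fields →ₗ[ℝ] (Fin 4 → ℝ) × (Fin 4 → ℝ) where
  toFun f :=
    (![f.1.1.1 0 0, f.1.2.1, f.1.1.1 1 1 + f.1.1.1 2 2 + f.2.2.2 0, f.2.2.2 0],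
      ![f.1.2.2 0, f.2.1.1 1 1 + f.2.1.1 2 2, f.2.2.1, f.2.1.1 0 0])
  map_add' f g := by
    refine Prod.ext (funext fun i => ?_) (funext fun i => ?_) <;> fin_cases i <;> simp <;> ring
  map_smul' r f := by
    refine Prod.ext (funext fun i => ?_) (funext fun i => ?_) <;> fin_cases i <;> simp <;> ring

/-- The vector part of a perturbation in an adapted frame, polarized in the `i`-th direction. -/
def vectorPart (i : Fin 3) : Fields × Fields →ₗ[ℝ] (Fin 2 → ℝ) × (Fin 2 → ℝ) where
  toFun f := (![f.1.1.1 0 i, f.2.2.2 i], ![f.1.2.2 i, f.2.1.1 0 i])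
  map_add' f g := by simp
  map_smul' r f := by simp

/-- The diagonal polarization of the tensor part of a perturbation in an adapted frame. -/
def tensorPartDiag : Fields × Fields →ₗ[ℝ] (Fin 1 → ℝ) × (Fin 1 → ℝ) where
  toFun f := (![f.1.1.1 1 1 - f.1.1.1 2 2], ![f.2.1.1 1 1 - f.2.1.1 2 2])
  map_add' f g := by simp [add_sub_add_comm]
  map_smul' r f := by simp [mul_sub]

/-- The other polarization of the tensor part of a perturbation in an adapted frame. -/
def tensorPartOffDiag : Fields × Fields →ₗ[ℝ] (Fin 1 → ℝ) × (Fin 1 → ℝ) where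
  toFun f := (![f.1.1.1 1 2], ![f.2.1.1 1 2])
  map_add' f g := by simp
  map_smul' r f := by simp

theorem scalarPart_apply (f : Fields × Fields) : scalarPart f =
    (![f.1.1.1 0 0, f.1.2.1, f.1.1.1 1 1 + f.1.1.1 2 2 + f.2.2.2 0, f.2.2.2 0],
      ![f.1.2.2 0, f.2.1.1 1 1 + f.2.1.1 2 2, f.2.2.1, f.2.1.1 0 0]) := rfl

theorem vectorPart_apply (i : Fin 3) (f : Fields × Fields) : vectorPart i f =
    (![f.1.1.1 0 i, f.2.2.2 i], ![f.1.2.2 i, f.2.1.1 0 i]) := rfl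

theorem tensorPartDiag_apply (f : Fields × Fields) : tensorPartDiag f =
    (![f.1.1.1 1 1 - f.1.1.1 2 2], ![f.2.1.1 1 1 - f.2.1.1 2 2]) := rfl

theorem tensorPartOffDiag_apply (f : Fields × Fields) : tensorPartOffDiag f =
    (![f.1.1.1 1 2], ![f.2.1.1 1 2]) := rfl

/-- The scalar sector of the principal symbol. -/
def scalarSymbol (C : Parameters) : Module.End ℝ ((Fin 4 → ℝ) × (Fin 4 → ℝ)) :=
  offDiag (scalarA (1 / 2 + C.C₁) (1 / 4 + 2 * C.C₄) C.C₇)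
    (scalarB C.lamVSq C.lamPlusSq C.C₅ +
      Matrix.single 0 3 (C.lamVSq - (1 + 2 * C.C₆)))

/-- The vector sector of the principal symbol. -/
def vectorSymbol (C : Parameters) : Module.End ℝ ((Fin 2 → ℝ) × (Fin 2 → ℝ)) :=
  offDiag vectorA (vectorB C.lamVSq (1 + 2 * C.C₆))

/-- The tensor sector of the principal symbol. -/
def tensorSymbol : Module.End ℝ ((Fin 1 → ℝ) × (Fin 1 → ℝ)) := offDiag !![2] !![1 / 2]

section Components

variable (C : Parameters) (f : Fields × Fields)

theorem frameSymbol_metric (i j : Fin 3) : (frameSymbol C f).1.1.1 i j = 2 * f.2.1.1 i j +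
    ((if i = 0 then f.1.2.2 j else 0) + (if j = 0 then f.1.2.2 i else 0)) -
    (if i = j then f.2.1.1.trace + (1 / 2 + C.C₁) * f.2.2.1 else 0) := rfl

theorem frameSymbol_lapse : (frameSymbol C f).1.2.1 =
    C.C₇ * f.1.2.2 0 - (1 / 2 + C.C₁) * f.2.1.1.trace + (1 / 4 + 2 * C.C₄) * f.2.2.1 := rfl

theorem frameSymbol_shift (i : Fin 3) : (frameSymbol C f).1.2.2 i =
    (1 + C.C₂) * f.1.1.1 0 i - (1 + 2 * C.C₆) * f.2.2.2 i - if i = 0 then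
      1 / 2 * (C.C₂ - C.C₃ + 1) * f.1.1.1.trace + (1 + C.C₅) * f.1.2.1 else 0 := rfl

theorem frameSymbol_metricMomentum (i j : Fin 3) : (frameSymbol C f).2.1.1 i j =
    1 / 2 * f.1.1.1 i j +
      ((if i = 0 then (1 + C.C₂) * f.2.2.2 j - f.1.1.1 0 j else 0) +
        (if j = 0 then (1 + C.C₂) * f.2.2.2 i - f.1.1.1 0 i else 0)) / 2 +
      (if i = 0 then if j = 0 then 1 / 2 * f.1.1.1.trace + f.1.2.1 else 0 else 0) +
      (if i = j then 1 / 2 * (f.1.1.1 0 0 - f.1.1.1.trace) - f.1.2.1 -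
        1 / 2 * (C.C₂ - C.C₃ + 1) * f.2.2.2 0 else 0) := rfl

theorem frameSymbol_lapseMomentum : (frameSymbol C f).2.2.1 =
    f.1.1.1 0 0 - f.1.1.1.trace - (1 + C.C₅) * f.2.2.2 0 := rfl

theorem frameSymbol_shiftMomentum (i : Fin 3) : (frameSymbol C f).2.2.2 i =
    2 * f.2.1.1 0 i + if i = 0 then C.C₇ * f.2.2.1 else 0 := rfl

theorem lamPlusSq_eq : C.lamPlusSq = C.C₂ + C.C₃ + 1 := by
  rw [Parameters.lamPlusSq]
  ring

theorem scalarPart_frameSymbol :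
    scalarPart (frameSymbol C f) = scalarSymbol C (scalarPart f) := by
  refine Prod.ext (funext fun i => ?_) (funext fun i => ?_) <;> fin_cases i <;>
  simp [scalarPart_apply, frameSymbol_metric, frameSymbol_lapse, frameSymbol_shift,
    frameSymbol_metricMomentum, frameSymbol_lapseMomentum, frameSymbol_shiftMomentum,
    scalarSymbol, offDiag_apply, scalarA, scalarB, Matrix.trace_fin_three, Matrix.mulVec,
    dotProduct, Fin.sum_univ_four, Matrix.single_apply, Parameters.lamVSq, lamPlusSq_eq] <;>
  ring

theorem vectorPart_frameSymbol {i : Fin 3} (hi : i ≠ 0) :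
    vectorPart i (frameSymbol C f) = vectorSymbol C (vectorPart i f) := by
  refine Prod.ext (funext fun j => ?_) (funext fun j => ?_) <;> fin_cases j <;>
  simp [vectorPart_apply, frameSymbol_metric, frameSymbol_shift, frameSymbol_metricMomentum,
    frameSymbol_shiftMomentum, vectorSymbol, offDiag_apply, vectorA, vectorB, hi, hi.symm,
    Parameters.lamVSq] <;>
  ring

theorem tensorPartDiag_frameSymbol :
    tensorPartDiag (frameSymbol C f) = tensorSymbol (tensorPartDiag f) := by
  refine Prod.ext (funext fun j => ?_) (funext fun j => ?_) <;> fin_cases j <;>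
  simp [tensorPartDiag_apply, frameSymbol_metric, frameSymbol_metricMomentum, tensorSymbol,
    offDiag_apply] <;>
  ring

theorem tensorPartOffDiag_frameSymbol :
    tensorPartOffDiag (frameSymbol C f) = tensorSymbol (tensorPartOffDiag f) := by
  refine Prod.ext (funext fun j => ?_) (funext fun j => ?_) <;> fin_cases j <;>
  simp [tensorPartOffDiag_apply, frameSymbol_metric, frameSymbol_metricMomentum, tensorSymbol,
    offDiag_apply] <;>
  ring

end Components

/-- The decomposition of perturbations in an adapted frame into scalars, vectors and tensors. -/
def sectors : Fields × Fields →ₗ[ℝ] ((Fin 4 → ℝ) × (Fin 4 → ℝ)) ×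
    (((Fin 2 → ℝ) × (Fin 2 → ℝ)) × ((Fin 2 → ℝ) × (Fin 2 → ℝ))) ×
    (((Fin 1 → ℝ) × (Fin 1 → ℝ)) × ((Fin 1 → ℝ) × (Fin 1 → ℝ))) :=
  scalarPart.prod (((vectorPart 1).prod (vectorPart 2)).prod
    (tensorPartDiag.prod tensorPartOffDiag))

theorem sectors_apply (f : Fields × Fields) :
    sectors f = (scalarPart f, (vectorPart 1 f, vectorPart 2 f),
      (tensorPartDiag f, tensorPartOffDiag f)) := rfl

theorem sectors_injective : Function.Injective sectors := by
  rw [← LinearMap.ker_eq_bot, LinearMap.ker_eq_bot']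
  rintro ⟨⟨q, a, v⟩, ⟨p, σ, r⟩⟩ h
  simp [sectors_apply, scalarPart_apply, vectorPart_apply, tensorPartDiag_apply,
    tensorPartOffDiag_apply] at h
  obtain ⟨⟨⟨q00, ha, q1, r0⟩, v0, p1, hσ, p00⟩,
    ⟨⟨⟨q01, r1⟩, v1, p01⟩, ⟨q02, r2⟩, v2, p02⟩, ⟨q2, p2⟩, q12, p12⟩ := h
  have q11 : q.1 1 1 = 0 := by linarith
  have q22 : q.1 2 2 = 0 := by linarith
  have p11 : p.1 1 1 = 0 := by linarith
  have p22 : p.1 2 2 = 0 := by linarith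
  have q10 : q.1 1 0 = 0 := (symTensor_symm q 1 0).trans q01
  have q20 : q.1 2 0 = 0 := (symTensor_symm q 2 0).trans q02
  have q21 : q.1 2 1 = 0 := (symTensor_symm q 2 1).trans q12
  have p10 : p.1 1 0 = 0 := (symTensor_symm p 1 0).trans p01
  have p20 : p.1 2 0 = 0 := (symTensor_symm p 2 0).trans p02
  have p21 : p.1 2 1 = 0 := (symTensor_symm p 2 1).trans p12
  refine Prod.ext (Fields.ext (fun i j => ?_) ha fun i => ?_)
    (Fields.ext (fun i j => ?_) hσ fun i => ?_)
  · fin_cases i <;> fin_cases j <;> assumption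
  · fin_cases i <;> assumption
  · fin_cases i <;> fin_cases j <;> assumption
  · fin_cases i <;> assumption

theorem sectors_surjective : Function.Surjective sectors := by
  rintro ⟨⟨e, o⟩, ⟨⟨e₁, o₁⟩, ⟨e₂, o₂⟩⟩, ⟨⟨e₃, o₃⟩, ⟨e₄, o₄⟩⟩⟩
  have hsymm : ∀ a b c d x y : ℝ, (!![a, b, c; b, d, x; c, x, y]).IsSymm := by
    intro a b c d x y
    ext i j
    fin_cases i <;> fin_cases j <;> rfl
  refine ⟨((⟨_, hsymm (e 0) (e₁ 0) (e₂ 0) ((e 2 - e 3 + e₃ 0) / 2) (e₄ 0) ((e 2 - e 3 - e₃ 0) / 2)⟩,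
      e 1, ![o 0, o₁ 0, o₂ 0]),
    (⟨_, hsymm (o 3) (o₁ 1) (o₂ 1) ((o 1 + o₃ 0) / 2) (o₄ 0) ((o 1 - o₃ 0) / 2)⟩,
      o 2, ![e 3, e₁ 1, e₂ 1])), ?_⟩
  rw [sectors_apply]
  refine Prod.ext (Prod.ext (funext fun i => ?_) (funext fun i => ?_))
    (Prod.ext (Prod.ext (Prod.ext (funext fun i => ?_) (funext fun i => ?_))
      (Prod.ext (funext fun i => ?_) (funext fun i => ?_)))
    (Prod.ext (Prod.ext (funext fun i => ?_) (funext fun i => ?_))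
      (Prod.ext (funext fun i => ?_) (funext fun i => ?_)))) <;>
  fin_cases i <;> simp [scalarPart_apply, vectorPart_apply, tensorPartDiag_apply, tensorPartOffDiag_apply] <;> ring

/-- The principal symbol in terms of scalars, vectors and tensors. -/
def sectorSymbol (C : Parameters) : Module.End ℝ (((Fin 4 → ℝ) × (Fin 4 → ℝ)) ×
    (((Fin 2 → ℝ) × (Fin 2 → ℝ)) × ((Fin 2 → ℝ) × (Fin 2 → ℝ))) ×
    (((Fin 1 → ℝ) × (Fin 1 → ℝ)) × ((Fin 1 → ℝ) × (Fin 1 → ℝ)))) :=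
  LinearMap.prodMap (scalarSymbol C) (LinearMap.prodMap
    (LinearMap.prodMap (vectorSymbol C) (vectorSymbol C))
    (LinearMap.prodMap tensorSymbol tensorSymbol))

theorem sectors_frameSymbol (C : Parameters) (f : Fields × Fields) :
    sectors (frameSymbol C f) = sectorSymbol C (sectors f) := by
  rw [sectors_apply, sectors_apply, scalarPart_frameSymbol, vectorPart_frameSymbol C f (by decide),
    vectorPart_frameSymbol C f (by decide), tensorPartDiag_frameSymbol,
    tensorPartOffDiag_frameSymbol]
  rfl

theorem eigSep_tensorSymbol : EigSep tensorSymbol := by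
  refine EigSep.offDiag_of_mul_eq_smul one_pos ?_
  ext i j
  fin_cases i; fin_cases j
  simp [Matrix.mul_apply]

theorem tensorSymbol_injective : Function.Injective tensorSymbol := by
  refine offDiag_injective ((Matrix.isUnit_iff_isUnit_det _).2 ?_)
  simp

/-- The vector sector supplies this relation for `C₆`, so the scalar sector has to be analysed only
without the correction term. -/
theorem scalarSymbol_eq {C : Parameters} (hC : 1 + 2 * C.C₆ = C.lamVSq) : scalarSymbol C =
    offDiag (scalarA (1 / 2 + C.C₁) (1 / 4 + 2 * C.C₄) C.C₇)
      (scalarB C.lamVSq C.lamPlusSq C.C₅) := by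
  rw [scalarSymbol, hC, sub_self, Matrix.single_zero, add_zero]

/-- The conditions on the parameters under which the principal symbol is diagonalizable. -/
def SectorConditions (C : Parameters) : Prop :=
  (0 < C.lamVSq ∧ 1 + 2 * C.C₆ = C.lamVSq) ∧
    ScalarConditions C.lamVSq C.lamPlusSq (1 / 2 + C.C₁) (1 / 4 + 2 * C.C₄) C.C₅ C.C₇ C.speedDisc

theorem speedDisc_eq (C : Parameters) : C.speedDisc =
    (2 * (1 / 2 + C.C₁) - C.C₇ + C.lamPlusSq - C.C₅ * C.C₇) ^ 2 -
      4 * ((2 * (1 / 2 + C.C₁) - C.C₇) * C.lamPlusSq) := by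
  simp only [Parameters.speedDisc, Parameters.lamPlusSq, Parameters.lamMinusSq]
  ring

theorem sectorConditions_of_eigSep {C : Parameters} (h : EigSep (frameSymbol C))
    (hm : 1 / 4 + 2 * C.C₄ + 3 * (1 / 2 + C.C₁) ^ 2 ≠ 0) : SectorConditions C := by
  let ε := LinearEquiv.ofBijective sectors ⟨sectors_injective, sectors_surjective⟩
  have h1 : EigSep (sectorSymbol C) := h.of_injective ε.symm.toLinearMap ε.symm.injective fun x => by
    refine ε.injective ?_
    change sectors (frameSymbol C (ε.symm x)) = ε (ε.symm (sectorSymbol C x))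
    rw [sectors_frameSymbol]
    change sectorSymbol C (ε (ε.symm x)) = _
    rw [LinearEquiv.apply_symm_apply, LinearEquiv.apply_symm_apply]
  have h2 : EigSep (vectorSymbol C) := h1.of_injective
    (LinearMap.inr ℝ _ _ ∘ₗ LinearMap.inl ℝ _ _ ∘ₗ LinearMap.inl ℝ _ _)
    (LinearMap.inr_injective.comp (LinearMap.inl_injective.comp LinearMap.inl_injective))
    fun x => by simp [sectorSymbol]
  have h3 : EigSep (scalarSymbol C) := h1.of_injective (LinearMap.inl ℝ _ _)
    LinearMap.inl_injective fun x => by simp [sectorSymbol]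
  have hv := eigSep_vector h2
  rw [scalarSymbol_eq hv.2] at h3
  exact ⟨hv, scalar_conditions h3 hm (speedDisc_eq C)⟩

theorem SectorConditions.eigSep {C : Parameters} (h : SectorConditions C) :
    EigSep (frameSymbol C) ∧ Function.Injective (frameSymbol C) := by
  obtain ⟨⟨hl, hC⟩, h⟩ := h
  obtain ⟨h1, h2⟩ := h.eigSep (speedDisc_eq C)
  rw [← scalarSymbol_eq hC] at h1
  have h3 := offDiag_injective h2
  rw [← scalarSymbol_eq hC] at h3
  have hv : vectorSymbol C = offDiag vectorA (vectorB C.lamVSq C.lamVSq) := by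
    rw [vectorSymbol, hC]
  have h4 : EigSep (vectorSymbol C) := by
    rw [hv]
    exact EigSep.offDiag_of_mul_eq_smul hl (vectorA_mul_vectorB_self _)
  have h5 : Function.Injective (vectorSymbol C) := by
    rw [hv]
    refine offDiag_injective ?_
    rw [vectorA_mul_vectorB_self]
    exact (Matrix.isUnit_iff_isUnit_det _).2 (by simp [hl.ne'])
  refine ⟨EigSep.of_injective (T := sectorSymbol C)
    (h1.prodMap ((h4.prodMap h4).prodMap (eigSep_tensorSymbol.prodMap eigSep_tensorSymbol)))
    sectors sectors_injective fun x => (sectors_frameSymbol C x).symm, ?_⟩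
  have h6 : Function.Injective (sectorSymbol C) :=
    h3.prodMap ((h5.prodMap h5).prodMap (tensorSymbol_injective.prodMap tensorSymbol_injective))
  intro x y hxy
  refine sectors_injective (h6 ?_)
  rw [← sectors_frameSymbol, hxy, sectors_frameSymbol]

/-! ### The three families -/

theorem lamMinusSq_eq (C : Parameters) : C.lamMinusSq = 2 * (1 / 2 + C.C₁) - C.C₇ := by
  rw [Parameters.lamMinusSq]
  ring

/-- With `N = λ_-²`, `P = λ_+²`, `X = 4l - 3P - 1` and `Y = 4m - N`, where `m = 1/4 + 2 c₄`, the
conditions read `c₅ Y = c₇ X`, `X d = c₅ q`, `Y d = c₇ q`. If `d ≠ 0`, division gives the first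
family. If `d = 0`, then `q = 0`; these two equations fix `c₅` and `P`, and only `c₅ Y = c₇ X`
remains, the second family. -/
theorem coupling_iff {l N P c₄ c₅ c₇ : ℝ} (hN : N ≠ 0)
    (hD : (N + P - c₅ * c₇) ^ 2 - 4 * (N * P) ≠ 0) :
    (c₅ * (4 * (1 / 4 + 2 * c₄) - N) = c₇ * (4 * l - 3 * P - 1) ∧
      (4 * l - 3 * P - 1) * ((1 + 2 * c₅) * N - P) = c₅ * (c₅ * N + 3 * c₇ * P) ∧
      (4 * (1 / 4 + 2 * c₄) - N) * ((1 + 2 * c₅) * N - P) = c₇ * (c₅ * N + 3 * c₇ * P)) ↔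
    ((1 + 2 * c₅) * N - P ≠ 0 ∧
      4 * l = 3 * P + 1 + (c₅ * N + 3 * c₇ * P) / ((1 + 2 * c₅) * N - P) * c₅ ∧
      8 * c₄ = N - 1 + (c₅ * N + 3 * c₇ * P) / ((1 + 2 * c₅) * N - P) * c₇) ∨
    (c₇ ≠ 0 ∧ c₇ ≠ -1 / 6 ∧ 12 * c₄ = 3 * N - 3 - 9 * c₇ - 2 * (1 + 6 * c₇) * (l - 1) ∧
      c₅ = -(3 * c₇) / (1 + 6 * c₇) ∧ P = N / (1 + 6 * c₇)) := by
  set d := (1 + 2 * c₅) * N - P with hd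
  set q := c₅ * N + 3 * c₇ * P with hq
  constructor
  · rintro ⟨h1, h2, h3⟩
    by_cases hd0 : d = 0
    · right
      -- With `d = 0` this would give `N = P` and a vanishing discriminant.
      have hne : c₅ = 0 → c₇ = 0 → False := by
        rintro rfl rfl
        exact hD (by linear_combination (2 * P - (N + P)) * (hd.symm.trans hd0) +
          (2 * N - 2 * P) * (hd.symm.trans hd0))
      have hq0 : q = 0 := by
        by_contra hq0
        rw [hd0, mul_zero, eq_comm, mul_eq_zero, or_iff_left hq0] at h2 h3
        exact hne h2 h3
      rw [hd, sub_eq_zero] at hd0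
      have h5 : c₅ * (1 + 6 * c₇) = -(3 * c₇) := by
        refine mul_left_cancel₀ hN ?_
        rw [hq, ← hd0] at hq0
        linear_combination hq0
      have he : 1 + 6 * c₇ ≠ 0 := fun he => by
        rw [he, mul_zero] at h5
        linarith
      have h7 : c₇ ≠ 0 := by
        rintro rfl
        exact hne (by simpa using h5) rfl
      have hPe : P * (1 + 6 * c₇) = N := by
        linear_combination -(1 + 6 * c₇) * hd0 + 2 * N * h5
      refine ⟨h7, fun h => he (by rw [h]; norm_num), ?_, by rw [eq_div_iff he, h5],
        by rw [eq_div_iff he, hPe]⟩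
      · have h8 : -3 * (4 * (1 / 4 + 2 * c₄) - N) = (1 + 6 * c₇) * (4 * l - 3 * P - 1) := by
          refine mul_left_cancel₀ h7 ?_
          linear_combination (1 + 6 * c₇) * h1 - (4 * (1 / 4 + 2 * c₄) - N) * h5
        linear_combination -h8 / 2 + 3 / 2 * hPe
    · left
      refine ⟨hd0, ?_, ?_⟩
      · field_simp
        linear_combination h2
      · field_simp
        linear_combination h3
  · rintro (⟨hd0, h1, h2⟩ | ⟨h7, h6, h4, h5, hPN⟩)
    · have hX : 4 * l - 3 * P - 1 = q / d * c₅ := by linear_combination h1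
      have hY : 4 * (1 / 4 + 2 * c₄) - N = q / d * c₇ := by linear_combination h2
      rw [hX, hY]
      refine ⟨by ring, ?_, ?_⟩ <;> field_simp
    · have he : 1 + 6 * c₇ ≠ 0 := fun he => h6 (by linarith)
      rw [eq_div_iff he] at h5 hPN
      have hd0 : d = 0 := by
        rw [hd, ← hPN]
        linear_combination 2 * P * h5
      have hq0 : q = 0 := by
        rw [hq, ← hPN]
        linear_combination P * h5
      rw [hd0, hq0]
      refine ⟨mul_left_cancel₀ he ?_, by simp, by simp⟩
      linear_combination (4 * (1 / 4 + 2 * c₄) - N) * h5 - 2 * c₇ * h4 + 3 * c₇ * hPN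

/-- A vanishing discriminant leaves only the third family; otherwise `coupling_iff` produces the
first two. -/
theorem mem_families_iff (C : Parameters) :
    C ∈ family₁ ∪ family₂ ∪ family₃ ↔ SectorConditions C := by
  have hD := speedDisc_eq C
  have hC6 : C.C₆ = (C.lamVSq - 1) / 2 ↔ 1 + 2 * C.C₆ = C.lamVSq := by
    constructor <;> intro h <;> linarith
  have hp : 0 < C.vPlusSq ↔
      0 < C.lamMinusSq + C.lamPlusSq - C.C₅ * C.C₇ + √C.speedDisc := by
    rw [Parameters.vPlusSq]
    constructor <;> intro h <;> linarith
  have hm : 0 < C.vMinusSq ↔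
      0 < C.lamMinusSq + C.lamPlusSq - C.C₅ * C.C₇ - √C.speedDisc := by
    rw [Parameters.vMinusSq]
    constructor <;> intro h <;> linarith
  have hv : 0 ≤ C.speedDisc → (C.vPlusSq = C.vMinusSq ↔ C.speedDisc = 0) := fun h0 => by
    rw [← Real.sqrt_eq_zero h0, Parameters.vPlusSq, Parameters.vMinusSq]
    constructor <;> intro h <;> linarith
  have hcommon : SectorConditions C ↔ C.CommonConditions ∧
      ((C.speedDisc = 0 ∧ C.C₅ = 0 ∧ C.C₇ = 0 ∧ 2 * (1 / 2 + C.C₁) = C.lamPlusSq ∧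
        4 * C.lamVSq = 3 * C.lamPlusSq + 1 ∧ 4 * (1 / 4 + 2 * C.C₄) = C.lamPlusSq) ∨
      (C.speedDisc ≠ 0 ∧
        C.C₅ * (4 * (1 / 4 + 2 * C.C₄) - C.lamMinusSq) =
          C.C₇ * (4 * C.lamVSq - 3 * C.lamPlusSq - 1) ∧
        (4 * C.lamVSq - 3 * C.lamPlusSq - 1) *
          ((1 + 2 * C.C₅) * C.lamMinusSq - C.lamPlusSq) =
            C.C₅ * (C.C₅ * C.lamMinusSq + 3 * C.C₇ * C.lamPlusSq) ∧
        (4 * (1 / 4 + 2 * C.C₄) - C.lamMinusSq) *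
          ((1 + 2 * C.C₅) * C.lamMinusSq - C.lamPlusSq) =
            C.C₇ * (C.C₅ * C.lamMinusSq + 3 * C.C₇ * C.lamPlusSq))) := by
    rw [SectorConditions, Parameters.CommonConditions, hC6, hp, hm, lamMinusSq_eq]
    constructor
    · rintro ⟨⟨h1, h2⟩, h3, h4, h5, h6⟩
      exact ⟨⟨h2, h1, h3, h4, h5⟩, h6⟩
    · rintro ⟨⟨h2, h1, h3, h4, h5⟩, h6⟩
      exact ⟨⟨h1, h2⟩, h3, h4, h5, h6⟩
  rw [← lamMinusSq_eq] at hD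
  rw [hcommon]
  have hw : ∀ {A B B₁ B₂ B₃ : Prop}, (A → (B₁ ∨ B₂ ∨ B₃ ↔ B)) →
      (((A ∧ B₁) ∨ (A ∧ B₂)) ∨ (A ∧ B₃) ↔ A ∧ B) := fun h => by
    rw [or_assoc, ← and_or_left, ← and_or_left, and_congr_right h]
  refine hw fun hC => ?_
  obtain ⟨-, -, h0, h1, h2⟩ := hC
  rw [hp] at h1
  rw [hm] at h2
  have hs : √C.speedDisc * √C.speedDisc = C.speedDisc := Real.mul_self_sqrt h0
  -- The product of the two positive squared speeds is `λ_-² λ_+²`.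
  have hNP : C.lamMinusSq * C.lamPlusSq ≠ 0 := fun h =>
    (mul_pos h1 h2).ne' (by linear_combination 4 * h - hs - hD)
  have hN := left_ne_zero_of_mul hNP
  simp only [ne_eq, hv h0]
  by_cases hD0 : C.speedDisc = 0
  · simp only [hD0, not_true_eq_false, false_and, and_false, false_or, or_false, true_and]
    rw [hD0, Real.sqrt_zero] at h1
    rw [lamMinusSq_eq] at h1 ⊢
    constructor
    · rintro ⟨-, h3, h5, h7, hl, h4⟩
      exact ⟨h5, h7, by linarith, hl, by linarith⟩
    · rintro ⟨h5, h7, h3, hl, h4⟩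
      rw [h5, h7] at h1
      exact ⟨by linarith, by linarith, h5, h7, hl, by linarith⟩
  · have := coupling_iff (l := C.lamVSq) (c₄ := C.C₄) hN (hD ▸ hD0)
    simp only [hD0, hN, not_false_eq_true, false_and, and_false, false_or, or_false, true_and]
    exact this.symm

/-! ### The kinetic matrix -/

/-- This number is, up to a nonzero factor, the determinant of `M⁻¹` on the trace and lapse momenta.
If it vanished, the pure trace momentum `-(1/2 + C₁) α γ^{ij}` together with `σ = 1` would lie in
the kernel. -/
theorem isUnit_Minv_ne_zero {C : Parameters} {b : Background} (hM : IsUnit (Minv C b)) :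
    1 / 4 + 2 * C.C₄ + 3 * (1 / 2 + C.C₁) ^ 2 ≠ 0 := by
  intro hm
  have hinj : Function.Injective (Minv C b) := ((Module.End.isUnit_iff _).1 hM).1
  have hγ : b.γ * b.inv = 1 :=
    Matrix.mul_nonsing_inv _ ((Matrix.isUnit_iff_isUnit_det _).1 b.γ_posDef.isUnit)
  have hγe : ∀ k l, ∑ m, b.γ k m * b.inv m l = (1 : Matrix (Fin 3) (Fin 3) ℝ) k l := fun k l => by
    rw [← hγ, Matrix.mul_apply]
  let p : SymTensor := ⟨b.inv, Matrix.ext fun k l => b.inv_symm l k⟩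
  have hlow : ∀ k l, b.lower p k l = b.γ k l := fun k l => by
    rw [lower, Finset.sum_comm]
    calc ∑ n, ∑ m, b.γ k m * b.γ l n * b.inv m n
        = ∑ n, b.γ l n * ∑ m, b.γ k m * b.inv m n := by
          simp only [Finset.mul_sum]
          exact Finset.sum_congr rfl fun n _ => Finset.sum_congr rfl fun m _ => by ring
      _ = b.γ k l := by
          simp only [hγe, Matrix.one_apply]
          simp [b.γ_symm l k]
  have htr : b.trUp p = 3 := by
    rw [trUp]
    calc ∑ m, ∑ n, b.γ m n * b.inv m n = ∑ m, ∑ n, b.γ m n * b.inv n m :=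
          Finset.sum_congr rfl fun m _ => Finset.sum_congr rfl fun n _ => by rw [b.inv_symm]
      _ = 3 := by simp [hγe]
  have h0 : Minv C b ((-(1 / 2 + C.C₁) * b.α) • p, 1, 0) = Minv C b 0 := by
    rw [map_zero]
    refine Fields.ext (fun k l => ?_) ?_ fun k => ?_
    · change b.α / b.vol * (2 * b.lower ((-(1 / 2 + C.C₁) * b.α) • p) k l -
        b.γ k l * b.trUp ((-(1 / 2 + C.C₁) * b.α) • p) -
          (1 / 2 + C.C₁) * b.α * b.γ k l * 1) = 0
      rw [lower_smul, trUp_smul, hlow, htr]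
      ring
    · change b.α / b.vol * (-(1 / 2 + C.C₁) * b.α * b.trUp ((-(1 / 2 + C.C₁) * b.α) • p) +
        (1 / 4 + 2 * C.C₄) * b.α ^ 2 * 1) = 0
      rw [trUp_smul, htr]
      linear_combination b.α / b.vol * b.α ^ 2 * hm
    · change b.α / b.vol * (-(1 + 2 * C.C₆) * b.α ^ 2 * b.raiseVec 0 k) = 0
      simp [raiseVec]
  exact one_ne_zero (congrArg (fun f : Fields => f.2.1) (hinj h0))

end HamiltonianGR

end

/-! ### The equivalences -/

open HamiltonianGR in
theorem mainTheorem6 (C : HamiltonianGR.Parameters) (b : HamiltonianGR.Background)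
    (hM : IsUnit (HamiltonianGR.Minv C b)) :
    List.TFAE [
      (HamiltonianGR.canonicalSystem C b).IsStronglyHyperbolic,
      HasContinuousEigenbasis (HamiltonianGR.canonicalSystem C b).symbol,
      (HamiltonianGR.fullySecondOrderForm C b).IsStronglyHyperbolic,
      HasContinuousEigenbasis (HamiltonianGR.fullySecondOrderForm C b).symbol,
      C ∈ HamiltonianGR.family₁ ∪ HamiltonianGR.family₂ ∪ HamiltonianGR.family₃] := by
  have h1 := locallyModelled_canonicalSystem C b
  have h2 := h1.fullySecondOrderForm hM
  -- Necessity uses only one covector, since the model `frameSymbol C` is the same for all.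
  have hs : (fun _ => 1 : Fin 3 → ℝ) ≠ 0 := fun h => one_ne_zero (congrFun h 0)
  have hsep : ∀ {P : (Fin 3 → ℝ) → Module.End ℝ (Fields × Fields)},
      LocallyModelled P b.β (frameSymbol C) → EigSep (P fun _ => 1) →
        C ∈ family₁ ∪ family₂ ∪ family₃ := fun h hP =>
    (mem_families_iff C).2
      (sectorConditions_of_eigSep (h.eigSep hs hP) (isUnit_Minv_ne_zero hM))
  tfae_have 1 → 5 := fun h => hsep h1 (h.eigSep hs)
  tfae_have 2 → 5 := fun h => hsep h1 (h.eigSep hs)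
  tfae_have 3 → 5 := fun h => hsep h2 (h.eigSep hs)
  tfae_have 4 → 5 := fun h => hsep h2 (h.eigSep hs)
  have hsuf : C ∈ family₁ ∪ family₂ ∪ family₃ → EigSep (frameSymbol C) ∧
      ∃ D' : Module.End ℝ (Fields × Fields), ∀ x, frameSymbol C (D' x) = x := fun h => by
    obtain ⟨h3, h4⟩ := ((mem_families_iff C).1 h).eigSep
    exact ⟨h3, _, (LinearEquiv.ofInjectiveEndo (frameSymbol C) h4).apply_symm_apply⟩
  tfae_have 5 → 2 := fun h => h1.hasContinuousEigenbasis (hsuf h).1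
  tfae_have 5 → 4 := fun h => h2.hasContinuousEigenbasis (hsuf h).1
  tfae_have 5 → 1 := fun h => by
    obtain ⟨h3, D', h4⟩ := hsuf h
    exact SecondOrderSystem.isStronglyHyperbolic_of_locallyModelled h1 h3 h4
  tfae_have 5 → 3 := fun h => by
    obtain ⟨h3, D', h4⟩ := hsuf h
    exact SecondOrderSystem.isStronglyHyperbolic_of_locallyModelled h2 h3 h4
  tfae_finish
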